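/- **Pivot orderings.** Let $m\ge 2$ and $\mathcal P_m=\{(r,s): 1\le r<s\le m\}$, $M=m(m-1)/2$. A *pivot ordering* is a sequence containing every element of $\mathcal P_m$ exactly once. Two pivot orderings are *equivalent* if one is obtained from the other by finitely many swaps of adjacent pairs $(i,j),(i',j')$ with $\{i,j\}\cap\{i',j'\}=\emptyset$; *shift-equivalent* if they are of the form $[\mathcal O_1,\mathcal O_2]$ and $[\mathcal O_2,\mathcal O_1]$; *weakly equivalent* ($\stackrel{\mathsf w}{\sim}$) if they are connected by a finite chain of orderings in which neighbours are equivalent or shift-equivalent; *permutation equivalent* ($\stackrel{\mathsf p}{\sim}$) if one is obtained from the other by replacing every pair $(i,j)$ with the pair of elements of $\{\mathsf q(i),\mathsf q(j)\}$, written in increasing order, for one permutation $\mathsf q$ of $\{1,\dots,m\}$. Let $\mathcal B_{sp}^{(m)}$ be the set of orderings that list the positions of $\mathcal P_m$ column by column for columns $2,3,\dots,m$, with an arbitrary order inside each column, or row by row for rows $m-1,m-2,\dots,1$, with an arbitrary order inside each row, together with the reverses of all these orderings. The set $\mathcal B_{sg}^{(m)}$ of *generalized serial* orderings consists of the pivot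 orderings $\mathcal O$ for which there are a pivot ordering $\mathcal O'$ and $\mathcal O''\in\mathcal B_{sp}^{(m)}$ with $\mathcal O\stackrel{\mathsf p}{\sim}\mathcal O'\stackrel{\mathsf w}{\sim}\mathcal O''$ or $\mathcal O\stackrel{\mathsf w}{\sim}\mathcal O'\stackrel{\mathsf p}{\sim}\mathcal O''$. **Block matrices.** Let $\pi=(n_1,\dots,n_m)$, $n_r\ge1$, $n_1+\dots+n_m=n$, and partition matrices $X\in\mathbb C^{n\times n}$ into blocks $X_{rs}\in\mathbb C^{n_r\times n_s}$. An *elementary block matrix* with pivot pair $(i,j)\in\mathcal P_m$ is a matrix which agrees with $I_n$ outside of the blocks $(i,i),(i,j),(j,i),(j,j)$. The pivot submatrix is $\widehat X_{ij}=\begin{bmatrix}X_{ii}&X_{ij}\\X_{ji}&X_{jj}\end{bmatrix}$, and $\operatorname{off}(X)=\|X-\operatorname{diag}(X)\|_F$, where $\operatorname{diag}(X)$ is the (element-wise) diagonal part of $X$. **Theorem.** Let $A\in\mathbb C^{n\times n}$, $A\neq0$, be Hermitian, partitioned according to $\pi$, and let $$A^{(k+1)}=\bigl(T^{(k)}\bigr)^*A^{(k)}T^{(k)},\quad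 k\ge0,\qquad A^{(0)}=A,$$ where $T^{(k)}$ is a nonsingular elementary block matrix with pivot pair $(i(k),j(k))$. Assume: * **A1** there is an ordering $\mathcal O\in\mathcal B_{sg}^{(m)}$ such that, for every $k\ge 0$, $(i(k),j(k))$ is the entry of $\mathcal O$ at position $k \bmod M$ (counted from $0$); * **A2** there are unitary elementary block matrices $U^{(k)}$, $k\ge0$, with $\lim_{k\to\infty}(T^{(k)}-U^{(k)})=0$; * **A3** $\displaystyle\liminf_{k\to\infty}\sigma_{\min}\bigl(T^{(k)}_{i(k)i(k)}\bigr)>0$, where $\sigma_{\min}$ is the smallest singular value. Then $$\lim_{k\to\infty}\frac{\operatorname{off}\bigl(\widehat A^{(k+1)}_{i(k)j(k)}\bigr)}{\|A^{(k)}\|_F}=0\quad\Longleftrightarrow\quad\lim_{k\to\infty}\frac{\operatorname{off}\bigl(A^{(k)}\bigr)}{\|A^{(k)}\|_F}=0 .$$ -/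

import Mathlib

open Filter Topology

/-! ### Pivot orderings (block indices `1, …, m` are represented by `Fin m`) -/

/-- `O` is a pivot ordering, i.e. a sequence in which every element of
`P_m = {(r, s) | r < s}` appears exactly once (and nothing else appears). -/
def IsPivotOrdering {m : ℕ} (O : List (Fin m × Fin m)) : Prop :=
  O.Nodup ∧ ∀ p : Fin m × Fin m, p ∈ O ↔ p.1 < p.2

/-- One admissible transposition: two adjacent pairs that are disjoint as sets are swapped. -/
def AdmissibleTransposition {m : ℕ} (O O' : List (Fin m × Fin m)) : Prop :=
  ∃ (L R : List (Fin m × Fin m)) (p q : Fin m × Fin m),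
    Disjoint ({p.1, p.2} : Set (Fin m)) {q.1, q.2} ∧
      O = L ++ p :: q :: R ∧ O' = L ++ q :: p :: R

/-- Equivalence: a finite number of admissible transpositions. -/
def OrderingEquiv {m : ℕ} : List (Fin m × Fin m) → List (Fin m × Fin m) → Prop :=
  Relation.ReflTransGen AdmissibleTransposition

/-- Shift-equivalence: `O = [O₁, O₂]` and `O' = [O₂, O₁]`. -/
def ShiftEquiv {m : ℕ} (O O' : List (Fin m × Fin m)) : Prop :=
  ∃ O₁ O₂ : List (Fin m × Fin m), O = O₁ ++ O₂ ∧ O' = O₂ ++ O₁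

/-- Weak equivalence: a finite chain whose neighbours are equivalent or shift-equivalent. -/
def WeakEquiv {m : ℕ} : List (Fin m × Fin m) → List (Fin m × Fin m) → Prop :=
  Relation.TransGen fun O O' => OrderingEquiv O O' ∨ ShiftEquiv O O'

/-- The pivot position of the unordered pair `{p.1, p.2}`: the smaller index comes first. -/
def sortPair {m : ℕ} (p : Fin m × Fin m) : Fin m × Fin m :=
  (min p.1 p.2, max p.1 p.2)

/-- Permutation equivalence: all indices are relabelled by a permutation `q` of the block indices.
The pairs `(i, j)` and `(j, i)` denote the same pivot position, so the relabelled pair is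
written with its smaller index first. -/
def PermEquiv {m : ℕ} (O O' : List (Fin m × Fin m)) : Prop :=
  ∃ q : Equiv.Perm (Fin m), O' = O.map fun p => sortPair (q p.1, q p.2)

/-- Column-wise orderings with permutations: the columns `1, …, m` are taken from left to right,
and the positions `(i, j)`, `i < j`, of column `j` are listed in an arbitrary order `c j`. -/
def colSerialOrderings (m : ℕ) : Set (List (Fin m × Fin m)) :=
  {O | ∃ c : Fin m → List (Fin m),
    (∀ j, (c j).Perm ((List.finRange m).filter fun i => i < j)) ∧
      O = (List.finRange m).flatMap fun j => (c j).map fun i => (i, j)}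

/-- Row-wise orderings with permutations: the rows `m, …, 1` are taken from bottom to top,
and the positions `(i, j)`, `i < j`, of row `i` are listed in an arbitrary order `c i`. -/
def rowSerialOrderings (m : ℕ) : Set (List (Fin m × Fin m)) :=
  {O | ∃ c : Fin m → List (Fin m),
    (∀ i, (c i).Perm ((List.finRange m).filter fun j => i < j)) ∧
      O = (List.finRange m).reverse.flatMap fun i => (c i).map fun j => (i, j)}

/-- Serial orderings with permutations: the two classes above and their reversals. -/
def serialOrderings (m : ℕ) : Set (List (Fin m × Fin m)) :=
  {O | O ∈ colSerialOrderings m ∨ O.reverse ∈ colSerialOrderings m ∨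
    O ∈ rowSerialOrderings m ∨ O.reverse ∈ rowSerialOrderings m}

/-- Generalized serial pivot orderings. -/
def generalizedSerialOrderings (m : ℕ) : Set (List (Fin m × Fin m)) :=
  {O | IsPivotOrdering O ∧ ∃ O' O'' : List (Fin m × Fin m),
    IsPivotOrdering O' ∧ O'' ∈ serialOrderings m ∧
      ((PermEquiv O O' ∧ WeakEquiv O' O'') ∨ (WeakEquiv O O' ∧ PermEquiv O' O''))}

/-- `I` is the cyclic pivot strategy defined by the ordering `O`: the pivot pair of step `k` is
the entry of `O` at (zero-based) position `k mod M`, where `M` is the length of `O`. -/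
def IsStrategyOf {m : ℕ} (O : List (Fin m × Fin m)) (I : ℕ → Fin m × Fin m) : Prop :=
  ∀ k, O[k % O.length]? = some (I k)

/-! ### Block matrices with partition `π = (n 0, …, n (m - 1))` -/

/-- Complex square matrices carrying the block partition `(n r)_r`; the index `⟨r, a⟩` is the
`a`-th index inside the `r`-th block. -/
abbrev BlockMatrix {m : ℕ} (n : Fin m → ℕ) : Type :=
  Matrix ((r : Fin m) × Fin (n r)) ((r : Fin m) × Fin (n r)) ℂ

/-- The block `A_{rs}`. -/
def BlockMatrix.block {m : ℕ} {n : Fin m → ℕ} (A : BlockMatrix n) (r s : Fin m) :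
    Matrix (Fin (n r)) (Fin (n s)) ℂ :=
  A.submatrix (fun a => ⟨r, a⟩) (fun b => ⟨s, b⟩)

/-- The pivot submatrix `Â_{ij}`, with blocks `A_{ii}, A_{ij}, A_{ji}, A_{jj}`, for `p = (i, j)`. -/
def BlockMatrix.pivotSubmatrix {m : ℕ} {n : Fin m → ℕ} (A : BlockMatrix n) (p : Fin m × Fin m) :
    Matrix (Fin (n p.1) ⊕ Fin (n p.2)) (Fin (n p.1) ⊕ Fin (n p.2)) ℂ :=
  Matrix.fromBlocks (A.block p.1 p.1) (A.block p.1 p.2) (A.block p.2 p.1) (A.block p.2 p.2)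

/-- `T` is an elementary block matrix with pivot pair `p = (i, j)`: it agrees with the identity
matrix outside of the blocks `(i, i), (i, j), (j, i), (j, j)`. -/
def BlockMatrix.IsElementaryAt {m : ℕ} {n : Fin m → ℕ} (T : BlockMatrix n)
    (p : Fin m × Fin m) : Prop :=
  ∀ x y : (r : Fin m) × Fin (n r),
    ¬ ((x.1 = p.1 ∨ x.1 = p.2) ∧ (y.1 = p.1 ∨ y.1 = p.2)) →
      T x y = (1 : BlockMatrix n) x y

/-- `T` is an elementary block matrix for some pivot pair `(i, j)`, `i < j`. -/
def BlockMatrix.IsElementary {m : ℕ} {n : Fin m → ℕ} (T : BlockMatrix n) : Prop :=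
  ∃ p : Fin m × Fin m, p.1 < p.2 ∧ T.IsElementaryAt p

section Frobenius

open scoped Matrix.Norms.Frobenius

/-- The Frobenius norm. -/
noncomputable def frobeniusNorm {ι : Type*} [Fintype ι] (A : Matrix ι ι ℂ) : ℝ := ‖A‖

end Frobenius

/-- The off-norm `‖A - diag(A)‖_F`, where `diag(A)` is the (element-wise) diagonal part. -/
noncomputable def offNorm {ι : Type*} [Fintype ι] [DecidableEq ι] (A : Matrix ι ι ℂ) : ℝ :=
  frobeniusNorm (A - Matrix.diagonal A.diag)

/-- The smallest singular value of a square complex matrix of order `d ≥ 1`. -/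
noncomputable def sigmaMin {d : ℕ} (B : Matrix (Fin d) (Fin d) ℂ) : ℝ :=
  ⨅ r : Fin d, (Matrix.toEuclideanLin B).singularValues r

/-! ### Block calculus for elementary block matrices -/

namespace BlockMatrix

open Matrix

variable {m : ℕ} {n : Fin m → ℕ}

/-! Convergence of the full off-norm implies that of the pivot off-norm because the pivot submatrix
is a principal submatrix of the new iterate, and consecutive Frobenius norms have ratio tending to 1
when the transformations are asymptotically unitary.

The other direction is a compactness argument. Scale the iterates to norm one, let ℓ be the limsup
of their off-norms, and pass to the limit, along an ultrafilter realizing ℓ, on a window of steps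
containing N full cycles. Each limit step is an exact unitary elementary congruence that leaves a
diagonal pivot submatrix, so it cannot increase the off-norm (`IsElementaryAt.offNorm_le`). The
off-norm is at most ℓ when the window opens and equal to ℓ when it closes, hence constant; a step
that removes nothing had a diagonal pivot submatrix already before it
(`IsElementaryAt.isPivotDiag_of_offNorm_eq`). Such steps are the stationary ones.

It remains to see that N cycles of stationary steps force a diagonal matrix, so that ℓ = 0. In a
sweep of column j over a block diagonal leading part (`StationaryChain.column`), the step (i, j)
turns a later block A_rj into A_rj U_jj, because A_ri = 0. This block is zero when its own turn
comes, and U_jj is invertible by A3 and unitarity, so A_rj was zero from the start. Stationary steps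
are reversible, commute when their pivots are disjoint, and ignore the orientation of pairs, while
the sweep argument works for any order of the blocks. This carries the conclusion to all generalized
serial orderings. -/

theorem block_mul (A B : BlockMatrix n) (r s : Fin m) :
    block (A * B) r s = ∑ t, block A r t * block B t s := by
  ext a b
  simp [block, Matrix.mul_apply, Fintype.sum_sigma, Matrix.sum_apply]

theorem block_conjTranspose (A : BlockMatrix n) (r s : Fin m) :
    block Aᴴ r s = (block A s r)ᴴ := rfl

theorem block_one_self (r : Fin m) : block (1 : BlockMatrix n) r r = 1 := by
  ext a b
  simp [block, Matrix.one_apply]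

theorem block_one_of_ne {r s : Fin m} (h : r ≠ s) : block (1 : BlockMatrix n) r s = 0 := by
  ext a b
  simp [block, h]

theorem IsElementaryAt.block_eq {U : BlockMatrix n} {p : Fin m × Fin m} (hU : U.IsElementaryAt p)
    {r s : Fin m} (h : ¬ ((r = p.1 ∨ r = p.2) ∧ (s = p.1 ∨ s = p.2))) :
    block U r s = block 1 r s := by
  ext a b
  exact hU ⟨r, a⟩ ⟨s, b⟩ h

theorem IsElementaryAt.swap {U : BlockMatrix n} {p : Fin m × Fin m} (hU : U.IsElementaryAt p) :
    U.IsElementaryAt p.swap := fun x y h => hU x y (by simpa [or_comm] using h)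

theorem IsElementaryAt.conjTranspose {U : BlockMatrix n} {p : Fin m × Fin m}
    (hU : U.IsElementaryAt p) : IsElementaryAt Uᴴ p := by
  intro x y h
  rw [Matrix.conjTranspose_apply, hU y x (fun h' => h h'.symm), ← Matrix.conjTranspose_apply,
    Matrix.conjTranspose_one]

/-- Right multiplication by an elementary matrix leaves the other block columns unchanged. -/
theorem IsElementaryAt.block_mul_of_ne {U : BlockMatrix n} {p : Fin m × Fin m}
    (hU : U.IsElementaryAt p) (A : BlockMatrix n) (r : Fin m) {s : Fin m}
    (h₁ : s ≠ p.1) (h₂ : s ≠ p.2) : block (A * U) r s = block A r s := by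
  rw [block_mul, Finset.sum_eq_single s]
  · rw [hU.block_eq (by tauto), block_one_self, Matrix.mul_one]
  · intro t _ ht
    rw [hU.block_eq (by tauto), block_one_of_ne ht, Matrix.mul_zero]
  · simp

/-- Right multiplication by an elementary matrix on a pivot block column. -/
theorem IsElementaryAt.block_mul_of_mem {U : BlockMatrix n} {p : Fin m × Fin m}
    (hU : U.IsElementaryAt p) (hp : p.1 ≠ p.2) (A : BlockMatrix n) (r : Fin m) {s : Fin m}
    (h : s = p.1 ∨ s = p.2) :
    block (A * U) r s = block A r p.1 * block U p.1 s + block A r p.2 * block U p.2 s := by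
  rw [block_mul]
  refine Fintype.sum_eq_add p.1 p.2 hp fun t ht => ?_
  rw [hU.block_eq (by tauto), block_one_of_ne (by rintro rfl; tauto), Matrix.mul_zero]

/-- Left multiplication by the adjoint leaves the other block rows unchanged. -/
theorem IsElementaryAt.block_conjTranspose_mul_of_ne {U : BlockMatrix n} {p : Fin m × Fin m}
    (hU : U.IsElementaryAt p) (A : BlockMatrix n) {r : Fin m} (s : Fin m)
    (h₁ : r ≠ p.1) (h₂ : r ≠ p.2) : block (Uᴴ * A) r s = block A r s := by
  have h := hU.block_mul_of_ne Aᴴ s h₁ h₂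
  rw [← Matrix.conjTranspose_conjTranspose A, ← Matrix.conjTranspose_mul, block_conjTranspose, h,
    block_conjTranspose, block_conjTranspose, block_conjTranspose]

/-- A3 controls only the first diagonal pivot block; unitarity transfers invertibility to the
second. If U_jj y = 0, block (i, j) of UᴴU = 1 gives U_iiᴴ U_ij y = 0, so U_ij y = 0, and then block
(j, j) gives y = 0. -/
theorem IsElementaryAt.isUnit_block_snd {U : BlockMatrix n} {p : Fin m × Fin m}
    (hU : U.IsElementaryAt p) (hp : p.1 ≠ p.2) (hU' : U ∈ unitaryGroup _ ℂ)
    (h : IsUnit (block U p.1 p.1)) : IsUnit (block U p.2 p.2) := by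
  have h1 : Uᴴ * U = 1 := by
    rw [← Matrix.star_eq_conjTranspose]; exact Unitary.star_mul_self_of_mem hU'
  have key (r : Fin m) : (block U p.1 r)ᴴ * block U p.1 p.2 + (block U p.2 r)ᴴ * block U p.2 p.2
      = block 1 r p.2 := by
    rw [← h1, hU.block_mul_of_mem hp _ _ (Or.inr rfl)]
    rfl
  rw [← Matrix.mulVec_injective_iff_isUnit, ← Matrix.coe_mulVecLin, ← LinearMap.ker_eq_bot,
    LinearMap.ker_eq_bot']
  intro y hy
  rw [Matrix.mulVecLin_apply] at hy
  have e1 := congrArg (fun M => M *ᵥ y) (key p.1)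
  have e2 := congrArg (fun M => M *ᵥ y) (key p.2)
  simp only [Matrix.add_mulVec, ← Matrix.mulVec_mulVec, hy, Matrix.mulVec_zero, add_zero,
    block_one_of_ne hp, block_one_self, Matrix.zero_mulVec, Matrix.one_mulVec] at e1 e2
  have hinj : Function.Injective ((block U p.1 p.1)ᴴ *ᵥ ·) :=
    Matrix.mulVec_injective_iff_isUnit.2 ((Matrix.isUnit_conjTranspose _).2 h)
  have e3 : block U p.1 p.2 *ᵥ y = 0 := hinj (by simpa using e1)
  rw [← e2, e3, Matrix.mulVec_zero]

end BlockMatrix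

/-! ### Stationary steps: exact unitary steps whose pivot submatrix is diagonal before and after -/

namespace BlockMatrix

open Matrix

variable {m : ℕ} {n : Fin m → ℕ}

/-- The matrices U - 1 and V - 1 are supported on disjoint sets of indices, so their products in
both orders vanish. -/
theorem IsElementaryAt.mul_comm_of_disjoint {U V : BlockMatrix n} {p q : Fin m × Fin m}
    (hU : U.IsElementaryAt p) (hV : V.IsElementaryAt q)
    (h : Disjoint ({p.1, p.2} : Set (Fin m)) {q.1, q.2}) : U * V = V * U := by
  have hd (r : Fin m) : ¬ ((r = p.1 ∨ r = p.2) ∧ (r = q.1 ∨ r = q.2)) :=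
    fun hr => Set.disjoint_left.1 h hr.1 hr.2
  have h1 : (U - 1) * (V - 1) = 0 := by
    ext x y
    rw [Matrix.mul_apply, Matrix.zero_apply]
    refine Finset.sum_eq_zero fun z _ => ?_
    by_cases hz : z.1 = p.1 ∨ z.1 = p.2
    · rw [Matrix.sub_apply V, hV z y (fun h' => hd _ ⟨hz, h'.1⟩), sub_self, mul_zero]
    · rw [Matrix.sub_apply U, hU x z (fun h' => hz h'.2), sub_self, zero_mul]
  have h2 : (V - 1) * (U - 1) = 0 := by
    ext x y
    rw [Matrix.mul_apply, Matrix.zero_apply]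
    refine Finset.sum_eq_zero fun z _ => ?_
    by_cases hz : z.1 = p.1 ∨ z.1 = p.2
    · rw [Matrix.sub_apply V, hV x z (fun h' => hd _ ⟨hz, h'.2⟩), sub_self, zero_mul]
    · rw [Matrix.sub_apply U, hU z y (fun h' => hz h'.1), sub_self, mul_zero]
  calc U * V = (U - 1) * (V - 1) + (U + V - 1) := by noncomm_ring
    _ = (V - 1) * (U - 1) + (U + V - 1) := by rw [h1, h2]
    _ = V * U := by noncomm_ring

/-- The pivot submatrix of `A` at the pivot pair `p` is diagonal. -/
def IsPivotDiag (A : BlockMatrix n) (p : Fin m × Fin m) : Prop :=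
  ∀ x y : (r : Fin m) × Fin (n r),
    (x.1 = p.1 ∨ x.1 = p.2) → (y.1 = p.1 ∨ y.1 = p.2) → x ≠ y → A x y = 0

theorem IsPivotDiag.block_eq_zero {A : BlockMatrix n} {p : Fin m × Fin m} (h : A.IsPivotDiag p)
    {r s : Fin m} (hr : r = p.1 ∨ r = p.2) (hs : s = p.1 ∨ s = p.2) (hrs : r ≠ s) :
    block A r s = 0 := by
  ext a b
  exact h ⟨r, a⟩ ⟨s, b⟩ hr hs (fun e => hrs (congrArg Sigma.fst e))

/-- One exact unitary step at the pivot pair `p` for which the pivot submatrix is diagonal both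
before and after the transformation; the diagonal blocks of the transformation are invertible. -/
structure IsStationaryStep (p : Fin m × Fin m) (A A' : BlockMatrix n) : Prop where
  ne : p.1 ≠ p.2
  isHermitian : A.IsHermitian
  diag : A.IsPivotDiag p
  diag' : A'.IsPivotDiag p
  exists_unitary : ∃ U : BlockMatrix n, U.IsElementaryAt p ∧ U ∈ unitaryGroup _ ℂ ∧
    IsUnit (block U p.1 p.1) ∧ IsUnit (block U p.2 p.2) ∧ A' = Uᴴ * A * U

namespace IsStationaryStep

variable {p q : Fin m × Fin m} {A A' B C : BlockMatrix n}

theorem isHermitian' (h : IsStationaryStep p A A') : A'.IsHermitian := by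
  obtain ⟨U, -, -, -, -, rfl⟩ := h.exists_unitary
  exact Matrix.isHermitian_conjTranspose_mul_mul U h.isHermitian

/-- The two ends play symmetric roles, and Uᴴ undoes U. Reversed orderings are later handled by
running chains backwards. -/
theorem symm (h : IsStationaryStep p A A') : IsStationaryStep p A' A := by
  refine ⟨h.ne, h.isHermitian', h.diag', h.diag, ?_⟩
  obtain ⟨U, hU, hU', h1, h2, rfl⟩ := h.exists_unitary
  have h3 : U * Uᴴ = 1 := Unitary.mul_star_self_of_mem hU'
  refine ⟨Uᴴ, hU.conjTranspose, Unitary.star_mem hU', (isUnit_conjTranspose _).2 h1,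
    (isUnit_conjTranspose _).2 h2, ?_⟩
  calc A = (U * Uᴴ) * A * (U * Uᴴ) := by rw [h3, Matrix.one_mul, Matrix.mul_one]
    _ = _ := by simp only [conjTranspose_conjTranspose, Matrix.mul_assoc]

theorem swap (h : IsStationaryStep p A A') : IsStationaryStep p.swap A A' := by
  refine ⟨h.ne.symm, h.isHermitian, fun x y hx hy => h.diag x y hx.symm hy.symm,
    fun x y hx hy => h.diag' x y hx.symm hy.symm, ?_⟩
  obtain ⟨U, hU, hU', h1, h2, e⟩ := h.exists_unitary
  exact ⟨U, hU.swap, hU', h2, h1, e⟩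

/-- Blocks away from the pivot are unchanged. -/
theorem block_eq (h : IsStationaryStep p A A') {r s : Fin m} (hr₁ : r ≠ p.1) (hr₂ : r ≠ p.2)
    (hs₁ : s ≠ p.1) (hs₂ : s ≠ p.2) : block A' r s = block A r s := by
  obtain ⟨U, hU, -, -, -, rfl⟩ := h.exists_unitary
  rw [hU.block_mul_of_ne _ _ hs₁ hs₂, hU.block_conjTranspose_mul_of_ne _ _ hr₁ hr₂]

/-- The new block is A_{r p₁} U_{p₁p₂} + A_{r p₂} U_{p₂p₂}; the first term vanishes and U_{p₂p₂} is
invertible. Information thus flows backwards in time, and this is where invertibility of a diagonal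
block is essential. -/
theorem block_eq_zero_of_snd (h : IsStationaryStep p A A') {r : Fin m} (hr₁ : r ≠ p.1)
    (hr₂ : r ≠ p.2) (h1 : block A r p.1 = 0) (h2 : block A' r p.2 = 0) : block A r p.2 = 0 := by
  obtain ⟨U, hU, -, -, hu, rfl⟩ := h.exists_unitary
  rw [Matrix.mul_assoc, hU.block_conjTranspose_mul_of_ne _ _ hr₁ hr₂,
    hU.block_mul_of_mem h.ne _ _ (Or.inr rfl), h1, Matrix.zero_mul, zero_add] at h2
  have h3 : block A r p.2 * block U p.2 p.2 * (block U p.2 p.2)⁻¹ = 0 := by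
    rw [h2, Matrix.zero_mul]
  rwa [Matrix.mul_assoc, Matrix.mul_nonsing_inv _ ((Matrix.isUnit_iff_isUnit_det _).1 hu),
    Matrix.mul_one] at h3

theorem block_eq_zero' (h : IsStationaryStep p A A') {r s : Fin m} (hr₁ : r ≠ p.1)
    (hr₂ : r ≠ p.2) (hs : s = p.1 ∨ s = p.2) (h1 : block A r p.1 = 0) (h2 : block A r p.2 = 0) :
    block A' r s = 0 := by
  obtain ⟨U, hU, -, -, hu, rfl⟩ := h.exists_unitary
  rw [Matrix.mul_assoc, hU.block_conjTranspose_mul_of_ne _ _ hr₁ hr₂,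
    hU.block_mul_of_mem h.ne _ _ hs, h1, h2, Matrix.zero_mul, Matrix.zero_mul, add_zero]

theorem isPivotDiag_congr (h : IsStationaryStep p A A')
    (hpq : Disjoint ({p.1, p.2} : Set (Fin m)) {q.1, q.2}) :
    A'.IsPivotDiag q ↔ A.IsPivotDiag q := by
  have hd (r : Fin m) (hr : r = q.1 ∨ r = q.2) : r ≠ p.1 ∧ r ≠ p.2 :=
    not_or.1 fun hr' => Set.disjoint_left.1 hpq hr' hr
  have key (x y : (r : Fin m) × Fin (n r)) (hx : x.1 = q.1 ∨ x.1 = q.2)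
      (hy : y.1 = q.1 ∨ y.1 = q.2) : A' x y = A x y :=
    congrFun (congrFun (h.block_eq (hd _ hx).1 (hd _ hx).2 (hd _ hy).1 (hd _ hy).2) x.2) y.2
  exact ⟨fun H x y hx hy hxy => by rw [← key x y hx hy, H x y hx hy hxy],
    fun H x y hx hy hxy => by rw [key x y hx hy, H x y hx hy hxy]⟩

/-- Steps with disjoint pivot pairs can be interchanged. -/
theorem exchange (h₁ : IsStationaryStep p A B) (h₂ : IsStationaryStep q B C)
    (hpq : Disjoint ({p.1, p.2} : Set (Fin m)) {q.1, q.2}) :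
    ∃ B', IsStationaryStep q A B' ∧ IsStationaryStep p B' C := by
  obtain ⟨U, hU, hU', hu1, hu2, e1⟩ := h₁.exists_unitary
  obtain ⟨V, hV, hV', hv1, hv2, e2⟩ := h₂.exists_unitary
  have hC : C = Uᴴ * (Vᴴ * A * V) * U := by
    have hUV := hU.mul_comm_of_disjoint hV hpq
    calc C = (U * V)ᴴ * A * (U * V) := by
          rw [e2, e1, conjTranspose_mul]; simp only [Matrix.mul_assoc]
      _ = _ := by rw [hUV, conjTranspose_mul]; simp only [Matrix.mul_assoc]
  have hAp := h₁.diag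
  have hAq := (h₁.isPivotDiag_congr hpq).1 h₂.diag
  have hCp := (h₂.isPivotDiag_congr hpq.symm).2 h₁.diag'
  have hCq := h₂.diag'
  -- The final step at p does not touch blocks away from p, so the pivot submatrix at q of VᴴAV can
  -- be read off from C.
  have key (x y : (r : Fin m) × Fin (n r)) (hx : x.1 ≠ p.1 ∧ x.1 ≠ p.2)
      (hy : y.1 ≠ p.1 ∧ y.1 ≠ p.2) : C x y = (Vᴴ * A * V) x y := by
    have : block C x.1 y.1 = block (Vᴴ * A * V) x.1 y.1 := by
      rw [hC, hU.block_mul_of_ne _ _ hy.1 hy.2, hU.block_conjTranspose_mul_of_ne _ _ hx.1 hx.2]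
    exact congrFun (congrFun this x.2) y.2
  have hd (r : Fin m) (hr : r = q.1 ∨ r = q.2) : r ≠ p.1 ∧ r ≠ p.2 :=
    not_or.1 fun hr' => Set.disjoint_left.1 hpq hr' hr
  have s1 : IsStationaryStep q A (Vᴴ * A * V) :=
    ⟨h₂.ne, h₁.isHermitian, hAq,
      fun x y hx hy hxy => by rw [← key x y (hd _ hx) (hd _ hy)]; exact hCq x y hx hy hxy,
      V, hV, hV', hv1, hv2, rfl⟩
  exact ⟨_, s1, h₁.ne, s1.isHermitian', (s1.isPivotDiag_congr hpq.symm).2 hAp, hCp,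
    U, hU, hU', hu1, hu2, hC⟩

end IsStationaryStep

/-- All off-diagonal blocks with block indices in `S` vanish. -/
def IsBlockDiagOn (A : BlockMatrix n) (S : Set (Fin m)) : Prop :=
  ∀ r ∈ S, ∀ s ∈ S, r ≠ s → block A r s = 0

theorem block_eq_zero_comm {A : BlockMatrix n} (hA : A.IsHermitian) {r s : Fin m}
    (h : block A r s = 0) : block A s r = 0 := by
  rw [← hA.eq, block_conjTranspose, h, conjTranspose_zero]

/-- Outside the pivot rows, the two pivot blocks of a row mix only with each other, so zeros stay
zeros; between the pivots, zeros come from the diagonal pivot submatrix after the step. -/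
theorem IsStationaryStep.isBlockDiagOn {p : Fin m × Fin m} {A A' : BlockMatrix n}
    (h : IsStationaryStep p A A') {S : Set (Fin m)} (h1 : p.1 ∈ S) (h2 : p.2 ∈ S)
    (hA : A.IsBlockDiagOn S) : A'.IsBlockDiagOn S := by
  have key (r s : Fin m) (hr : r ∈ S) (hr₁ : r ≠ p.1) (hr₂ : r ≠ p.2)
      (hs : s = p.1 ∨ s = p.2) : block A' r s = 0 :=
    h.block_eq_zero' hr₁ hr₂ hs (hA r hr _ h1 hr₁) (hA r hr _ h2 hr₂)
  intro r hr s hs hrs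
  by_cases hr' : r = p.1 ∨ r = p.2 <;> by_cases hs' : s = p.1 ∨ s = p.2
  · exact h.diag'.block_eq_zero hr' hs' hrs
  · exact block_eq_zero_comm h.isHermitian'
      (key s r hs (fun e => hs' (Or.inl e)) (fun e => hs' (Or.inr e)) hr')
  · exact key r s hr (fun e => hr' (Or.inl e)) (fun e => hr' (Or.inr e)) hs'
  · rw [not_or] at hr' hs'
    rw [h.block_eq hr'.1 hr'.2 hs'.1 hs'.2, hA r hr s hs hrs]

theorem IsStationaryStep.isDiag {p : Fin m × Fin m} {A A' : BlockMatrix n}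
    (h : IsStationaryStep p A A') (hA : A.IsDiag) : A'.IsDiag := by
  have hb : A'.IsBlockDiagOn Set.univ := by
    refine h.isBlockDiagOn trivial trivial fun r _ s _ hrs => ?_
    ext a b
    exact hA (i := ⟨r, a⟩) (j := ⟨s, b⟩) (fun e => hrs (congrArg Sigma.fst e))
  rintro ⟨r, a⟩ ⟨s, b⟩ hxy
  by_cases hrs : r = s
  · subst hrs
    by_cases hr : r = p.1 ∨ r = p.2
    · exact h.diag' _ _ hr hr hxy
    · rw [not_or] at hr
      exact (congrFun (congrFun (h.block_eq hr.1 hr.2 hr.1 hr.2) a) b).trans (hA hxy)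
  · exact congrFun (congrFun (hb r trivial s trivial hrs) a) b

/-- A chain of stationary steps along a list of pivot pairs. -/
def StationaryChain : List (Fin m × Fin m) → BlockMatrix n → BlockMatrix n → Prop
  | [], A, A' => A = A'
  | p :: L, A, A' => ∃ B, IsStationaryStep p A B ∧ StationaryChain L B A'

/-! ### Chains of stationary steps and the block column sweep -/

namespace StationaryChain

variable {L L₁ L₂ : List (Fin m × Fin m)} {A A' : BlockMatrix n}

theorem append_iff :
    StationaryChain (L₁ ++ L₂) A A' ↔ ∃ B, StationaryChain L₁ A B ∧ StationaryChain L₂ B A' := by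
  induction L₁ generalizing A with
  | nil => simp [StationaryChain]
  | cons p L ih => simp only [List.cons_append, StationaryChain, ih]; grind

theorem reverse (h : StationaryChain L A A') : StationaryChain L.reverse A' A := by
  induction L generalizing A with
  | nil => exact h.symm
  | cons p L ih =>
    obtain ⟨B, h1, h2⟩ := h
    rw [List.reverse_cons, append_iff]
    exact ⟨B, ih h2, A, h1.symm, rfl⟩

theorem isHermitian (h : StationaryChain L A A') (hA : A.IsHermitian) : A'.IsHermitian := by
  induction L generalizing A with
  | nil => exact h ▸ hA
  | cons p L ih =>
    obtain ⟨B, h1, h2⟩ := h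
    exact ih h2 h1.isHermitian'

theorem isDiag (h : StationaryChain L A A') (hA : A.IsDiag) : A'.IsDiag := by
  induction L generalizing A with
  | nil => exact h ▸ hA
  | cons p L ih =>
    obtain ⟨B, h1, h2⟩ := h
    exact ih h2 (h1.isDiag hA)

/-- By reversibility, diagonality may be established at whichever end of the chain is convenient. -/
theorem isDiag_iff (h : StationaryChain L A A') : A'.IsDiag ↔ A.IsDiag :=
  ⟨h.reverse.isDiag, h.isDiag⟩

theorem isBlockDiagOn (h : StationaryChain L A A') {S : Set (Fin m)}
    (hS : ∀ p ∈ L, p.1 ∈ S ∧ p.2 ∈ S) (hA : A.IsBlockDiagOn S) : A'.IsBlockDiagOn S := by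
  induction L generalizing A with
  | nil => exact h ▸ hA
  | cons p L ih =>
    obtain ⟨B, h1, h2⟩ := h
    have := hS p (by simp)
    exact ih h2 (fun q hq => hS q (by simp [hq])) (h1.isBlockDiagOn this.1 this.2 hA)

/-- Orientation of the pivot pairs is irrelevant. -/
theorem map {f : Fin m × Fin m → Fin m × Fin m} (hf : ∀ p ∈ L, f p = p ∨ f p = p.swap)
    (h : StationaryChain L A A') : StationaryChain (L.map f) A A' := by
  induction L generalizing A with
  | nil => exact h
  | cons p L ih =>
    obtain ⟨B, h1, h2⟩ := h
    refine ⟨B, ?_, ih (fun q hq => hf q (by simp [hq])) h2⟩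
    rcases hf p (by simp) with e | e <;> rw [e]
    exacts [h1, h1.swap]

/-- Diagonal blocks of the starting matrix which occur in the pivot list are diagonal. -/
theorem block_diag (h : StationaryChain L A A') {r : Fin m}
    (hr : ∃ p ∈ L, r = p.1 ∨ r = p.2) (a b : Fin (n r)) (hab : a ≠ b) : A ⟨r, a⟩ ⟨r, b⟩ = 0 := by
  induction L generalizing A with
  | nil => simp at hr
  | cons p L ih =>
    obtain ⟨B, h1, h2⟩ := h
    by_cases hp : r = p.1 ∨ r = p.2
    · exact h1.diag ⟨r, a⟩ ⟨r, b⟩ hp hp (by simpa using hab)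
    · have hp' := not_or.1 hp
      have e := congrFun (congrFun (h1.block_eq hp'.1 hp'.2 hp'.1 hp'.2) a) b
      refine e.symm.trans (ih h2 ?_)
      obtain ⟨q, hq, hq'⟩ := hr
      rcases List.mem_cons.1 hq with rfl | hq
      · exact absurd hq' hp
      · exact ⟨q, hq, hq'⟩

/-- Sweeping through one block column. -/
theorem column {c : List (Fin m)} {j : Fin m} (hc : c.Nodup) (hj : j ∉ c)
    (h : StationaryChain (c.map fun i => (i, j)) A A') (hA : A.IsBlockDiagOn {i | i ∈ c}) :
    ∀ i ∈ c, block A i j = 0 := by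
  induction c generalizing A with
  | nil => simp
  | cons i c ih =>
    obtain ⟨B, h1, h2⟩ := h
    rw [List.nodup_cons] at hc
    simp only [List.mem_cons, not_or] at hj
    have hne (r : Fin m) (hr : r ∈ c) : r ≠ i ∧ r ≠ j := by grind
    have hB : B.IsBlockDiagOn {i | i ∈ c} := by
      intro r hr s hs hrs
      rw [h1.block_eq (hne r hr).1 (hne r hr).2 (hne s hs).1 (hne s hs).2]
      exact hA r (by simp_all) s (by simp_all) hrs
    intro r hr
    rcases List.mem_cons.1 hr with rfl | hr
    · exact h1.diag.block_eq_zero (Or.inl rfl) (Or.inr rfl) (Ne.symm hj.1)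
    -- By induction block (r, j) is zero after the step, and block (r, i) is zero before it by block
    -- diagonality on the column's indices.
    · exact h1.block_eq_zero_of_snd (hne r hr).1 (hne r hr).2
        (hA r (by simp [hr]) i (by simp) (hne r hr).1) (ih hc.2 hj.2 h2 hB r hr)

/-- Sweeping through all block columns, in the order `l`; `l₀` lists the columns which are
already dealt with. -/
theorem columns {c : Fin m → List (Fin m)} {l₀ l : List (Fin m)} (hl : (l₀ ++ l).Nodup)
    (hc : ∀ l₁ j l₂, l₁ ++ j :: l₂ = l₀ ++ l → (c j).Perm l₁)
    (h : StationaryChain (l.flatMap fun j => (c j).map fun i => (i, j)) A A')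
    (hH : A.IsHermitian) (hA : A.IsBlockDiagOn {i | i ∈ l₀}) :
    A'.IsBlockDiagOn {i | i ∈ l₀ ++ l} := by
  induction l generalizing l₀ A with
  | nil => obtain rfl : A = A' := h; simpa using hA
  | cons j l ih =>
    rw [List.flatMap_cons, append_iff] at h
    obtain ⟨B, h1, h2⟩ := h
    have hp := hc l₀ j l rfl
    have hn : l₀.Nodup := hl.of_append_left
    have hj : j ∉ l₀ := fun hj => (List.disjoint_of_nodup_append hl) hj (by simp)
    have hcol := column (hp.nodup_iff.2 hn) (by rwa [hp.mem_iff]) h1 (by simpa [hp.mem_iff] using hA)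
    -- Column j turns out to be zero already before its sweep. Block diagonality thus extends to j
    -- in A, and the sweep preserves it.
    have hA₁ : A.IsBlockDiagOn {i | i ∈ l₀ ++ [j]} := by
      intro r hr s hs hrs
      simp only [List.mem_append, List.mem_singleton, Set.mem_ofPred_eq] at hr hs
      rcases hr with hr | rfl <;> rcases hs with hs | rfl
      · exact hA r hr s hs hrs
      · exact hcol r (hp.mem_iff.2 hr)
      · exact block_eq_zero_comm hH (hcol s (hp.mem_iff.2 hs))
      · exact absurd rfl hrs
    have hB : B.IsHermitian := h1.isHermitian hH
    have := ih (l₀ := l₀ ++ [j]) (by simpa using hl) (by simpa using hc) h2 hB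
      (h1.isBlockDiagOn (by
        intro p hp'
        obtain ⟨i, hi, rfl⟩ := List.mem_map.1 hp'
        exact ⟨by simp [hp.mem_iff.1 hi], by simp⟩) hA₁)
    simpa using this

end StationaryChain

end BlockMatrix

/-! ### Generalized serial orderings force stationary chains to be diagonal -/

namespace BlockMatrix

open Matrix

variable {m : ℕ} {n : Fin m → ℕ}

/-- Every chain of stationary steps along `L` starts at a diagonal matrix. -/
def IsDiagonalizing (n : Fin m → ℕ) (L : List (Fin m × Fin m)) : Prop :=
  ∀ A A' : BlockMatrix n, StationaryChain L A A' → A.IsDiag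

namespace IsDiagonalizing

variable {L L' : List (Fin m × Fin m)}

theorem mono (h : IsDiagonalizing n L')
    (hL : ∀ A A' : BlockMatrix n, StationaryChain L A A' → StationaryChain L' A A') :
    IsDiagonalizing n L := fun A A' hA => h A A' (hL A A' hA)

theorem of_reverse (h : IsDiagonalizing n L.reverse) : IsDiagonalizing n L :=
  fun _ _ hA => hA.isDiag_iff.1 (h _ _ hA.reverse)

theorem append (h : IsDiagonalizing n L) (L₁ L₂ : List (Fin m × Fin m)) :
    IsDiagonalizing n (L₁ ++ L ++ L₂) := by
  intro A A' hA
  obtain ⟨C, hC, -⟩ := StationaryChain.append_iff.1 hA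
  obtain ⟨B, hB, hBC⟩ := StationaryChain.append_iff.1 hC
  exact hB.isDiag_iff.1 (h _ _ hBC)

end IsDiagonalizing

/-- Column sweeps in an arbitrary order `l` of the block columns. -/
theorem isDiagonalizing_columns (hm : 2 ≤ m) {l : List (Fin m)} (hl : l.Nodup)
    (hl' : ∀ r, r ∈ l) {c : Fin m → List (Fin m)}
    (hc : ∀ l₁ j l₂, l₁ ++ j :: l₂ = l → (c j).Perm l₁) :
    IsDiagonalizing n (l.flatMap fun j => (c j).map fun i => (i, j)) := by
  intro A A' h
  set L := l.flatMap fun j => (c j).map fun i => (i, j) with hL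
  have hmem (r s : Fin m) (hrs : r ≠ s) : (r, s) ∈ L ∨ (s, r) ∈ L := by
    obtain ⟨l₁, l₂, e⟩ := List.append_of_mem (hl' r)
    have hs := hl' s
    rw [e, List.mem_append, List.mem_cons] at hs
    simp only [hL, List.mem_flatMap, List.mem_map, Prod.mk.injEq]
    rcases hs with hs | rfl | hs
    · exact Or.inr ⟨r, hl' r, s, (hc l₁ r l₂ e.symm).mem_iff.2 hs, rfl, rfl⟩
    · exact absurd rfl hrs
    · obtain ⟨l₃, l₄, e'⟩ := List.append_of_mem hs
      refine Or.inl ⟨s, hl' s, r, ?_, rfl, rfl⟩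
      rw [(hc (l₁ ++ r :: l₃) s l₄ (by simp [e, e'])).mem_iff]
      simp
  have hocc (r : Fin m) : ∃ p ∈ L, r = p.1 ∨ r = p.2 := by
    have : Nontrivial (Fin m) := Fin.nontrivial_iff_two_le.2 hm
    obtain ⟨s, hs⟩ := exists_ne r
    rcases hmem r s hs.symm with h | h
    exacts [⟨_, h, Or.inl rfl⟩, ⟨_, h, Or.inr rfl⟩]
  have hH : A.IsHermitian := by
    obtain ⟨p, hp, -⟩ := hocc ⟨0, by omega⟩
    obtain ⟨q, L', e⟩ := List.exists_cons_of_ne_nil (List.ne_nil_of_mem hp)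
    rw [e] at h
    obtain ⟨B, h1, -⟩ := h
    exact h1.isHermitian
  have hb : A'.IsBlockDiagOn {i | i ∈ [] ++ l} :=
    h.columns (by simpa using hl) (by simpa using hc) hH (by intro r hr; simp at hr)
  rw [← h.isDiag_iff]
  rintro ⟨r, a⟩ ⟨s, b⟩ hxy
  by_cases hrs : r = s
  · subst hrs
    obtain ⟨p, hp, hp'⟩ := hocc r
    -- The reversed chain starts at the final matrix and meets every block index, since m ≥ 2; hence
    -- each diagonal block is diagonal.
    exact h.reverse.block_diag ⟨p, by simpa using hp, hp'⟩ a b (by simpa using hxy)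
  · exact congrFun (congrFun (hb r (by simpa using hl' r) s (by simpa using hl' s) hrs) a) b

/-- Column sweeps along a chain `l` of a relation `R`, with relabelled block indices. -/
theorem isDiagonalizing_columns_map (hm : 2 ≤ m) {R : Fin m → Fin m → Prop} [DecidableRel R]
    [Std.Asymm R] {l : List (Fin m)} (hl : l.Pairwise R) (hl' : ∀ r, r ∈ l)
    {c : Fin m → List (Fin m)} (hc : ∀ j, (c j).Perm (l.filter fun i => R i j))
    (q : Equiv.Perm (Fin m)) :
    IsDiagonalizing n ((l.flatMap fun j => (c j).map fun i => (i, j)).map (Prod.map q q)) := by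
  have key : IsDiagonalizing n ((l.map q).flatMap fun j =>
      ((c (q.symm j)).map q).map fun i => (i, j)) := by
    have hirr (a : Fin m) : ¬ R a a := fun h => Std.Asymm.asymm _ _ h h
    refine isDiagonalizing_columns hm ?_ (fun r => ?_) fun l₁ j l₂ e => ?_
    · refine List.Nodup.map q.injective (List.Pairwise.imp ?_ hl)
      rintro a _ h rfl
      exact hirr a h
    · exact List.mem_map.2 ⟨q.symm r, hl' _, by simp⟩
    · obtain ⟨k₁, k₂, rfl, rfl, e₂⟩ := List.map_eq_append_iff.1 e.symm
      obtain ⟨i, k₃, rfl, rfl, rfl⟩ := List.map_eq_cons_iff.1 e₂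
      rw [Equiv.symm_apply_apply]
      refine ((hc i).trans (List.Perm.of_eq ?_)).map q
      rw [List.pairwise_append, List.pairwise_cons] at hl
      -- As `l` is a chain for the asymmetric relation `R`, the entries related to `i` are exactly
      -- those standing before it.
      have h1 : k₁.filter (fun a => R a i) = k₁ :=
        List.filter_eq_self.2 fun a ha => by simpa using hl.2.2 a ha i (by simp)
      have h2 : k₃.filter (fun a => R a i) = [] :=
        List.filter_eq_nil_iff.2 fun a ha => by
          simpa using fun h => Std.Asymm.asymm _ _ h (hl.2.1.1 a ha)
      rw [List.filter_append, List.filter_cons_of_neg (by simpa using hirr i), h1, h2,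
        List.append_nil]
  convert key using 1
  simp [List.map_flatMap, List.flatMap_map, Function.comp_def]

theorem isDiagonalizing_of_mem_serialOrderings (hm : 2 ≤ m) {O : List (Fin m × Fin m)}
    (hO : O ∈ serialOrderings m) (q : Equiv.Perm (Fin m)) :
    IsDiagonalizing n (O.map (Prod.map q q)) := by
  have hcol (O : List (Fin m × Fin m)) (hO : O ∈ colSerialOrderings m) :
      IsDiagonalizing n (O.map (Prod.map q q)) := by
    obtain ⟨c, hc, rfl⟩ := hO
    exact isDiagonalizing_columns_map (R := (· < ·)) hm (List.pairwise_lt_finRange m)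
      List.mem_finRange hc q
  have hrow (O : List (Fin m × Fin m)) (hO : O ∈ rowSerialOrderings m) :
      IsDiagonalizing n (O.map (Prod.map q q)) := by
    obtain ⟨c, hc, rfl⟩ := hO
    -- With each pair swapped, rows taken from bottom to top become columns for the reversed order
    -- of the blocks.
    have := isDiagonalizing_columns_map (n := n) (R := (· > ·)) (l := (List.finRange m).reverse)
      hm (List.pairwise_reverse.2 (List.pairwise_lt_finRange m)) (by simp)
      (fun j => (hc j).trans ((List.reverse_perm _).symm.filter _)) q
    refine this.mono fun A A' h => ?_
    convert h.map (f := Prod.swap) (fun _ _ => Or.inr rfl) using 1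
    simp [List.map_flatMap, Function.comp_def]
  rcases hO with hO | hO | hO | hO
  · exact hcol O hO
  · exact .of_reverse (by simpa using hcol _ hO)
  · exact hrow O hO
  · exact .of_reverse (by simpa using hrow _ hO)

/-- After any relabelling of the block indices, sufficiently many repetitions of `O` force a
stationary chain to be diagonal. -/
def IsCyclicallyDiagonalizing (n : Fin m → ℕ) (O : List (Fin m × Fin m)) : Prop :=
  ∀ q : Equiv.Perm (Fin m), ∃ N,
    IsDiagonalizing n (List.replicate N (O.map (Prod.map q q))).flatten

theorem StationaryChain.exchange {L R : List (Fin m × Fin m)} {p q : Fin m × Fin m}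
    (hpq : Disjoint ({p.1, p.2} : Set (Fin m)) {q.1, q.2}) {A A' : BlockMatrix n}
    (h : StationaryChain (L ++ p :: q :: R) A A') :
    StationaryChain (L ++ q :: p :: R) A A' := by
  rw [append_iff] at h ⊢
  obtain ⟨B, h1, C, h2, D, h3, h4⟩ := h
  obtain ⟨C', h5, h6⟩ := h2.exchange h3 hpq
  exact ⟨B, h1, C', h5, D, h6, h4⟩

theorem StationaryChain.replicate_mono {L L' : List (Fin m × Fin m)}
    (hL : ∀ A A' : BlockMatrix n, StationaryChain L A A' → StationaryChain L' A A') (N : ℕ)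
    {A A' : BlockMatrix n} (h : StationaryChain (List.replicate N L).flatten A A') :
    StationaryChain (List.replicate N L').flatten A A' := by
  induction N generalizing A with
  | zero => simpa using h
  | succ N ih =>
    rw [List.replicate_succ, List.flatten_cons, append_iff] at h ⊢
    obtain ⟨B, h1, h2⟩ := h
    exact ⟨B, hL _ _ h1, ih h2⟩

/-! ### Invariance under the equivalences of orderings -/

namespace IsCyclicallyDiagonalizing

variable {O O' : List (Fin m × Fin m)}

theorem of_admissibleTransposition (hO : AdmissibleTransposition O O')
    (h : IsCyclicallyDiagonalizing n O') : IsCyclicallyDiagonalizing n O := by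
  obtain ⟨L, R, p, q, hpq, rfl, rfl⟩ := hO
  intro σ
  obtain ⟨N, hN⟩ := h σ
  refine ⟨N, hN.mono fun A A' => StationaryChain.replicate_mono (fun A A' hA => ?_) N⟩
  rw [List.map_append, List.map_cons, List.map_cons] at hA ⊢
  refine hA.exchange ?_
  have := (Set.disjoint_image_iff σ.injective).2 hpq
  rw [Set.image_pair, Set.image_pair] at this
  exact this

theorem of_orderingEquiv (hO : OrderingEquiv O O') (h : IsCyclicallyDiagonalizing n O') :
    IsCyclicallyDiagonalizing n O := by
  induction hO using Relation.ReflTransGen.head_induction_on with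
  | refl => exact h
  | head h1 _ ih => exact ih.of_admissibleTransposition h1

/-- Since (O₁O₂)^(N+1) = O₁(O₂O₁)^N O₂, one extra cycle absorbs a shift. This is the reason for
allowing repetitions. -/
theorem of_shiftEquiv (hO : ShiftEquiv O O') (h : IsCyclicallyDiagonalizing n O') :
    IsCyclicallyDiagonalizing n O := by
  obtain ⟨O₁, O₂, rfl, rfl⟩ := hO
  intro σ
  obtain ⟨N, hN⟩ := h σ
  refine ⟨N + 1, ?_⟩
  rw [List.map_append] at hN ⊢
  have key (a b : List (Fin m × Fin m)) : (List.replicate (N + 1) (a ++ b)).flatten =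
      a ++ (List.replicate N (b ++ a)).flatten ++ b := by
    clear hN
    induction N with
    | zero => simp
    | succ N ih => rw [List.replicate_succ, List.flatten_cons, ih]; simp [List.replicate_succ]
  rw [key]
  exact hN.append _ _

theorem of_weakEquiv (hO : WeakEquiv O O') (h : IsCyclicallyDiagonalizing n O') :
    IsCyclicallyDiagonalizing n O := by
  have step (O O' : List (Fin m × Fin m)) (hO : OrderingEquiv O O' ∨ ShiftEquiv O O')
      (h : IsCyclicallyDiagonalizing n O') : IsCyclicallyDiagonalizing n O :=
    hO.elim h.of_orderingEquiv h.of_shiftEquiv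
  induction hO using Relation.TransGen.head_induction_on with
  | single h1 => exact step _ _ h1 h
  | head h1 _ ih => exact step _ _ h1 ih

theorem of_permEquiv (hO : PermEquiv O O') (h : IsCyclicallyDiagonalizing n O') :
    IsCyclicallyDiagonalizing n O := by
  obtain ⟨q, rfl⟩ := hO
  intro σ
  -- Relabelling `O'` by σq⁻¹ relabels `O` by σ, up to the orientation of pairs, which sorting may
  -- have flipped.
  obtain ⟨N, hN⟩ := h (σ * q⁻¹)
  refine ⟨N, hN.mono fun A A' => StationaryChain.replicate_mono (fun A A' hA => ?_) N⟩
  set r := σ * q⁻¹ with hr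
  have hf (p : Fin m × Fin m) : Prod.map r r (sortPair (Prod.map r.symm r.symm p)) = p ∨
      Prod.map r r (sortPair (Prod.map r.symm r.symm p)) = p.swap := by
    rcases le_total (r.symm p.1) (r.symm p.2) with h | h
    · left; simp [sortPair, h]
    · right; simp [sortPair, h, Prod.swap]
  convert hA.map (f := fun p => Prod.map r r (sortPair (Prod.map r.symm r.symm p)))
    (fun p _ => hf p) using 1
  have hrσ (i : Fin m) : r.symm (σ i) = q i := by
    simp [Equiv.symm_apply_eq, hr]
  simp [hrσ, Function.comp_def]

theorem of_mem_serialOrderings (hm : 2 ≤ m) (hO : O ∈ serialOrderings m) :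
    IsCyclicallyDiagonalizing n O := fun q =>
  ⟨1, by simpa using isDiagonalizing_of_mem_serialOrderings hm hO q⟩

theorem of_mem_generalizedSerialOrderings (hm : 2 ≤ m) (hO : O ∈ generalizedSerialOrderings m) :
    IsCyclicallyDiagonalizing n O := by
  obtain ⟨-, O', O'', -, h, ⟨h1, h2⟩ | ⟨h1, h2⟩⟩ := hO
  · exact ((of_mem_serialOrderings hm h).of_weakEquiv h2).of_permEquiv h1
  · exact ((of_mem_serialOrderings hm h).of_permEquiv h2).of_weakEquiv h1

end IsCyclicallyDiagonalizing

end BlockMatrix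

/-! ### Frobenius norm and off-norm -/

section Frobenius

open Matrix

variable {ι κ : Type*} [Fintype ι] [Fintype κ]

theorem frobeniusNorm_sq (A : Matrix ι ι ℂ) : frobeniusNorm A ^ 2 = ∑ x, ∑ y, ‖A x y‖ ^ 2 := by
  rw [frobeniusNorm, Matrix.frobenius_norm_def, ← Real.sqrt_eq_rpow, Real.sq_sqrt (by positivity)]
  simp

theorem frobeniusNorm_nonneg (A : Matrix ι ι ℂ) : 0 ≤ frobeniusNorm A := by
  rw [frobeniusNorm, Matrix.frobenius_norm_def]; positivity

theorem frobeniusNorm_eq_sqrt (A : Matrix ι ι ℂ) :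
    frobeniusNorm A = √(∑ x, ∑ y, ‖A x y‖ ^ 2) := by
  rw [← frobeniusNorm_sq, Real.sqrt_sq (frobeniusNorm_nonneg A)]

theorem continuous_frobeniusNorm : Continuous (frobeniusNorm : Matrix ι ι ℂ → ℝ) := by
  rw [show (frobeniusNorm : Matrix ι ι ℂ → ℝ) = _ from funext frobeniusNorm_eq_sqrt]
  fun_prop

theorem frobeniusNorm_eq_zero {A : Matrix ι ι ℂ} (h : frobeniusNorm A = 0) : A = 0 := by
  let _ := Matrix.frobeniusNormedAddCommGroup (m := ι) (n := ι) (α := ℂ)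
  exact norm_eq_zero.1 h

theorem frobeniusNorm_pos {A : Matrix ι ι ℂ} (h : A ≠ 0) : 0 < frobeniusNorm A :=
  (frobeniusNorm_nonneg A).lt_of_ne fun e => h (frobeniusNorm_eq_zero e.symm)

theorem frobeniusNorm_smul (c : ℝ) (A : Matrix ι ι ℂ) :
    frobeniusNorm (c • A) = |c| * frobeniusNorm A := by
  rw [← sq_eq_sq₀ (frobeniusNorm_nonneg _) (mul_nonneg (abs_nonneg c) (frobeniusNorm_nonneg A)),
    mul_pow, frobeniusNorm_sq, frobeniusNorm_sq, Finset.mul_sum]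
  refine Finset.sum_congr rfl fun x _ => ?_
  rw [Finset.mul_sum]
  refine Finset.sum_congr rfl fun y _ => ?_
  rw [Matrix.smul_apply, norm_smul, mul_pow, Real.norm_eq_abs]

theorem norm_apply_le_frobeniusNorm (A : Matrix ι ι ℂ) (x y : ι) : ‖A x y‖ ≤ frobeniusNorm A := by
  refine le_of_sq_le_sq ?_ (frobeniusNorm_nonneg A)
  rw [frobeniusNorm_sq]
  calc ‖A x y‖ ^ 2 ≤ ∑ y, ‖A x y‖ ^ 2 :=
        Finset.single_le_sum (f := fun y => ‖A x y‖ ^ 2) (fun _ _ => by positivity)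
          (Finset.mem_univ y)
    _ ≤ _ := Finset.single_le_sum (f := fun x => ∑ y, ‖A x y‖ ^ 2) (fun _ _ => by positivity)
          (Finset.mem_univ x)

theorem frobeniusNorm_sq_eq_trace (A : Matrix ι ι ℂ) :
    ((frobeniusNorm A ^ 2 : ℝ) : ℂ) = (Aᴴ * A).trace := by
  rw [frobeniusNorm_sq, Matrix.trace, Finset.sum_comm]
  push_cast
  refine Finset.sum_congr rfl fun x _ => ?_
  rw [Matrix.diag_apply, Matrix.mul_apply]
  refine Finset.sum_congr rfl fun y _ => ?_
  rw [Matrix.conjTranspose_apply, ← Complex.conj_mul']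
  rfl

variable [DecidableEq ι] [DecidableEq κ]

/-- The squared norm is the trace of AᴴA, and the trace is cyclic. -/
theorem frobeniusNorm_conj {U : Matrix ι ι ℂ} (hU : U ∈ unitaryGroup ι ℂ) (A : Matrix ι ι ℂ) :
    frobeniusNorm (Uᴴ * A * U) = frobeniusNorm A := by
  have h : U * Uᴴ = 1 := Unitary.mul_star_self_of_mem hU
  rw [← sq_eq_sq₀ (frobeniusNorm_nonneg _) (frobeniusNorm_nonneg _), ← Complex.ofReal_inj,
    frobeniusNorm_sq_eq_trace, frobeniusNorm_sq_eq_trace]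
  calc ((Uᴴ * A * U)ᴴ * (Uᴴ * A * U)).trace
      = (Uᴴ * (Aᴴ * (U * Uᴴ) * A * U)).trace := by
        simp only [conjTranspose_mul, conjTranspose_conjTranspose, Matrix.mul_assoc]
    _ = (Aᴴ * A * (U * Uᴴ)).trace := by
        rw [Matrix.trace_mul_comm, h, Matrix.mul_one, Matrix.mul_assoc, h]
    _ = _ := by rw [h, Matrix.mul_one]

theorem offNorm_nonneg (A : Matrix ι ι ℂ) : 0 ≤ offNorm A := frobeniusNorm_nonneg _

theorem continuous_offNorm : Continuous (offNorm : Matrix ι ι ℂ → ℝ) := by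
  refine continuous_frobeniusNorm.comp ?_
  fun_prop

theorem offNorm_smul (c : ℝ) (A : Matrix ι ι ℂ) : offNorm (c • A) = |c| * offNorm A := by
  rw [offNorm, offNorm, ← frobeniusNorm_smul, smul_sub, Matrix.diag_smul, Matrix.diagonal_smul]

theorem offNorm_sq (A : Matrix ι ι ℂ) :
    offNorm A ^ 2 = ∑ x, ∑ y, if x = y then 0 else ‖A x y‖ ^ 2 := by
  rw [offNorm, frobeniusNorm_sq]
  refine Finset.sum_congr rfl fun x _ => Finset.sum_congr rfl fun y _ => ?_
  split_ifs with h
  · subst h; simp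
  · simp [h]

theorem offNorm_sq_add (A : Matrix ι ι ℂ) :
    offNorm A ^ 2 + ∑ x, ‖A x x‖ ^ 2 = frobeniusNorm A ^ 2 := by
  rw [offNorm_sq, frobeniusNorm_sq, ← Finset.sum_add_distrib]
  refine Finset.sum_congr rfl fun x _ => ?_
  rw [← Finset.add_sum_erase _ _ (Finset.mem_univ x),
    ← Finset.add_sum_erase _ (fun y => ‖A x y‖ ^ 2) (Finset.mem_univ x), if_pos rfl, zero_add,
    add_comm]
  congr 1
  exact Finset.sum_congr rfl fun y hy => if_neg (Finset.ne_of_mem_erase hy).symm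

theorem offNorm_eq_zero_iff (A : Matrix ι ι ℂ) : offNorm A = 0 ↔ A.IsDiag := by
  rw [Matrix.isDiag_iff_diagonal_diag]
  constructor
  · intro h
    exact (sub_eq_zero.1 (frobeniusNorm_eq_zero h)).symm
  · intro h
    rw [offNorm, h, sub_self, frobeniusNorm_eq_sqrt]
    simp

theorem offNorm_submatrix_le (A : Matrix ι ι ℂ) {e : κ → ι} (he : Function.Injective e) :
    offNorm (A.submatrix e e) ≤ offNorm A := by
  refine le_of_sq_le_sq ?_ (offNorm_nonneg A)
  rw [offNorm_sq, offNorm_sq, ← Fintype.sum_prod_type', ← Fintype.sum_prod_type']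
  have h := Finset.sum_le_univ_sum_of_nonneg
    (s := (Finset.univ : Finset (κ × κ)).map ⟨Prod.map e e, he.prodMap he⟩)
    (f := fun p : ι × ι => if p.1 = p.2 then 0 else ‖A p.1 p.2‖ ^ 2)
    (fun p => by split_ifs <;> positivity)
  refine le_trans (le_of_eq ?_) h
  rw [Finset.sum_map]
  simp [he.eq_iff]

end Frobenius

/-! ### Pivot submatrices, reduction of the off-norm, and the determinant bound -/

namespace BlockMatrix

open Matrix

variable {m : ℕ} {n : Fin m → ℕ}

theorem pivotSubmatrix_eq_submatrix (A : BlockMatrix n) (p : Fin m × Fin m) :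
    A.pivotSubmatrix p = A.submatrix (Sum.elim (fun a => ⟨p.1, a⟩) (fun b => ⟨p.2, b⟩))
      (Sum.elim (fun a => ⟨p.1, a⟩) (fun b => ⟨p.2, b⟩)) := by
  ext (a | a) (b | b) <;> rfl

theorem continuous_pivotSubmatrix (p : Fin m × Fin m) :
    Continuous fun A : BlockMatrix n => A.pivotSubmatrix p := by
  simp only [pivotSubmatrix_eq_submatrix]
  fun_prop

theorem pivotSubmatrix_smul (c : ℝ) (A : BlockMatrix n) (p : Fin m × Fin m) :
    pivotSubmatrix (c • A) p = c • A.pivotSubmatrix p := by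
  simp only [pivotSubmatrix_eq_submatrix]
  rfl

theorem offNorm_pivotSubmatrix_le (A : BlockMatrix n) {p : Fin m × Fin m} (hp : p.1 ≠ p.2) :
    offNorm (A.pivotSubmatrix p) ≤ offNorm A := by
  rw [pivotSubmatrix_eq_submatrix]
  refine offNorm_submatrix_le A ?_
  rintro (a | a) (b | b) h <;> simp_all [Sigma.mk.injEq]

theorem isPivotDiag_of_offNorm_eq_zero {A : BlockMatrix n} {p : Fin m × Fin m}
    (h : offNorm (A.pivotSubmatrix p) = 0) : A.IsPivotDiag p := by
  rw [offNorm_eq_zero_iff] at h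
  rintro ⟨r, a⟩ ⟨s, b⟩ hr hs hxy
  dsimp only at hr hs
  rcases hr with rfl | rfl
  · by_cases hs' : s = p.1
    · subst hs'
      exact h (i := Sum.inl a) (j := Sum.inl b) (by simpa using hxy)
    · obtain rfl := hs.resolve_left hs'
      exact h (i := Sum.inl a) (j := Sum.inr b) (by simp)
  · by_cases hs' : s = p.2
    · subst hs'
      exact h (i := Sum.inr a) (j := Sum.inr b) (by simpa using hxy)
    · obtain rfl := hs.resolve_right hs'
      exact h (i := Sum.inr a) (j := Sum.inl b) (by simp)

/-- The diagonal projection onto the pivot blocks. -/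
noncomputable def pivotProjection (n : Fin m → ℕ) (p : Fin m × Fin m) : BlockMatrix n :=
  diagonal fun x => if x.1 = p.1 ∨ x.1 = p.2 then 1 else 0

theorem pivotProjection_mul_mul_apply (A : BlockMatrix n) (p : Fin m × Fin m)
    (x y : (r : Fin m) × Fin (n r)) :
    (pivotProjection n p * A * pivotProjection n p) x y =
      if (x.1 = p.1 ∨ x.1 = p.2) ∧ (y.1 = p.1 ∨ y.1 = p.2) then A x y else 0 := by
  rw [pivotProjection, Matrix.mul_diagonal, Matrix.diagonal_mul]
  split_ifs <;> simp_all

theorem IsElementaryAt.pivotProjection_comm {U : BlockMatrix n} {p : Fin m × Fin m}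
    (hU : U.IsElementaryAt p) : pivotProjection n p * U = U * pivotProjection n p := by
  ext x y
  rw [pivotProjection, Matrix.mul_diagonal, Matrix.diagonal_mul]
  by_cases h : (x.1 = p.1 ∨ x.1 = p.2) ∧ (y.1 = p.1 ∨ y.1 = p.2)
  · rw [if_pos h.1, if_pos h.2, one_mul, mul_one]
  · rw [hU x y h]
    by_cases hxy : x = y
    · subst hxy; rw [mul_comm]
    · simp [Matrix.one_apply_ne hxy]

/-- A unitary transformation changes the squared off-norm by as much as that of the pivot
submatrix. -/
theorem IsElementaryAt.offNorm_sq_sub {U : BlockMatrix n} {p : Fin m × Fin m}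
    (hU : U.IsElementaryAt p) (hU' : U ∈ unitaryGroup _ ℂ) (A : BlockMatrix n) :
    offNorm (Uᴴ * A * U) ^ 2 -
        offNorm (pivotProjection n p * (Uᴴ * A * U) * pivotProjection n p) ^ 2 =
      offNorm A ^ 2 - offNorm (pivotProjection n p * A * pivotProjection n p) ^ 2 := by
  set E := pivotProjection n p with hE
  have hEU : E * U = U * E := hU.pivotProjection_comm
  have hEU' : E * Uᴴ = Uᴴ * E := hU.conjTranspose.pivotProjection_comm
  have h1 := frobeniusNorm_conj hU' A
  -- The projection commutes with U, so the compressed matrix also undergoes a unitary conjugation.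
  have h2 : frobeniusNorm (E * (Uᴴ * A * U) * E) = frobeniusNorm (E * A * E) := by
    rw [← frobeniusNorm_conj hU' (E * A * E)]
    congr 1
    calc E * (Uᴴ * A * U) * E = (E * Uᴴ) * A * (U * E) := by simp only [Matrix.mul_assoc]
      _ = _ := by rw [hEU', ← hEU]; simp only [Matrix.mul_assoc]
  have h3 : ∑ x, ‖(Uᴴ * A * U) x x‖ ^ 2 - ∑ x, ‖(E * (Uᴴ * A * U) * E) x x‖ ^ 2 =
      ∑ x, ‖A x x‖ ^ 2 - ∑ x, ‖(E * A * E) x x‖ ^ 2 := by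
    rw [← Finset.sum_sub_distrib, ← Finset.sum_sub_distrib]
    refine Finset.sum_congr rfl fun x _ => ?_
    rw [hE, pivotProjection_mul_mul_apply, pivotProjection_mul_mul_apply]
    by_cases hx : x.1 = p.1 ∨ x.1 = p.2
    · simp only [hx, and_self, if_true, sub_self]
    · have hx' := not_or.1 hx
      have : block (Uᴴ * A * U) x.1 x.1 = block A x.1 x.1 := by
        rw [hU.block_mul_of_ne _ _ hx'.1 hx'.2, hU.block_conjTranspose_mul_of_ne _ _ hx'.1 hx'.2]
      have e : (Uᴴ * A * U) x x = A x x := congrFun (congrFun this x.2) x.2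
      simp only [hx, and_self, if_false, e]
  have e1 := offNorm_sq_add (Uᴴ * A * U)
  have e2 := offNorm_sq_add A
  have e3 := offNorm_sq_add (E * (Uᴴ * A * U) * E)
  have e4 := offNorm_sq_add (E * A * E)
  rw [h1] at e1
  rw [h2] at e3
  linarith

theorem isDiag_pivotProjection_iff {A : BlockMatrix n} {p : Fin m × Fin m} :
    (pivotProjection n p * A * pivotProjection n p).IsDiag ↔ A.IsPivotDiag p := by
  constructor
  · intro h x y hx hy hxy
    have : (pivotProjection n p * A * pivotProjection n p) x y = 0 := h hxy
    rwa [pivotProjection_mul_mul_apply, if_pos ⟨hx, hy⟩] at this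
  · intro h x y hxy
    rw [pivotProjection_mul_mul_apply]
    split_ifs with h'
    · exact h x y h'.1 h'.2 hxy
    · rfl

theorem IsElementaryAt.offNorm_le {U A : BlockMatrix n} {p : Fin m × Fin m}
    (hU : U.IsElementaryAt p) (hU' : U ∈ unitaryGroup _ ℂ) (h : IsPivotDiag (Uᴴ * A * U) p) :
    offNorm (Uᴴ * A * U) ≤ offNorm A := by
  have h1 := hU.offNorm_sq_sub hU' A
  rw [(offNorm_eq_zero_iff _).2 (isDiag_pivotProjection_iff.2 h)] at h1
  refine le_of_sq_le_sq ?_ (offNorm_nonneg A)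
  nlinarith [sq_nonneg (offNorm (pivotProjection n p * A * pivotProjection n p))]

/-- The squared off-norm drops by exactly the pivot's share, so equality forces that share to be
zero. -/
theorem IsElementaryAt.isPivotDiag_of_offNorm_eq {U A : BlockMatrix n} {p : Fin m × Fin m}
    (hU : U.IsElementaryAt p) (hU' : U ∈ unitaryGroup _ ℂ) (h : IsPivotDiag (Uᴴ * A * U) p)
    (hA : offNorm (Uᴴ * A * U) = offNorm A) : A.IsPivotDiag p := by
  have h1 := hU.offNorm_sq_sub hU' A
  rw [(offNorm_eq_zero_iff _).2 (isDiag_pivotProjection_iff.2 h), hA] at h1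
  rw [← isDiag_pivotProjection_iff, ← offNorm_eq_zero_iff]
  exact pow_eq_zero_iff two_ne_zero |>.1 (by linarith)

/-- A lower bound on the smallest singular value yields a lower bound on the determinant. -/
theorem _root_.pow_sigmaMin_le_norm_det {d : ℕ} (B : Matrix (Fin d) (Fin d) ℂ) {c : ℝ}
    (hc : 0 ≤ c) (h : c ≤ sigmaMin B) : c ^ d ≤ ‖B.det‖ := by
  have h1 := (Matrix.toEuclideanLin B).normDet_eq_norm_det
  rw [LinearMap.normDet_eq_prod_singularValues, finrank_euclideanSpace_fin,
    ← Fin.prod_univ_eq_prod_range] at h1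
  have h2 : LinearMap.det (Matrix.toEuclideanLin B) = B.det := by
    rw [Matrix.toEuclideanLin, Matrix.toLpLin_eq_toLin, LinearMap.det_toLin]
  rw [← h2, ← h1]
  calc c ^ d = ∏ _r : Fin d, c := by simp
    _ ≤ _ := Finset.prod_le_prod (fun _ _ => hc) fun r _ => h.trans (ciInf_le
        ⟨0, by rintro _ ⟨r, rfl⟩; exact LinearMap.singularValues_nonneg _ _⟩ r)

end BlockMatrix

/-! ### Limits of asymptotically unitary processes -/

namespace BlockMatrix

open Matrix

variable {m : ℕ} {n : Fin m → ℕ}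

/-- A product of closed discs is compact. With an ultrafilter, all sequences needed later converge
simultaneously, without successive extraction of subsequences. -/
theorem exists_tendsto_of_norm_apply_le {α ι : Type*} (𝒰 : Ultrafilter α)
    {F : α → Matrix ι ι ℂ} {c : ℝ} (hF : ∀ k x y, ‖F k x y‖ ≤ c) :
    ∃ G, Tendsto F 𝒰 (𝓝 G) := by
  have hK : IsCompact (Set.univ.pi fun _ : ι =>
      Set.univ.pi fun _ : ι => Metric.closedBall (0 : ℂ) c) :=
    isCompact_univ_pi fun _ => isCompact_univ_pi fun _ => isCompact_closedBall _ _
  obtain ⟨G, -, hG⟩ := hK.ultrafilter_le_nhds (𝒰.map F) (le_principal_iff.2 (mem_map.2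
    (Eventually.of_forall fun k x _ y _ => by simpa using hF k x y)))
  exact ⟨G, hG⟩

theorem exists_tendsto_unitary {α ι : Type*} [Fintype ι] [DecidableEq ι] (𝒰 : Ultrafilter α)
    {T U : α → Matrix ι ι ℂ} (hU : ∀ k, U k ∈ unitaryGroup ι ℂ)
    (hTU : Tendsto (fun k => T k - U k) 𝒰 (𝓝 0)) :
    ∃ u ∈ unitaryGroup ι ℂ, Tendsto T 𝒰 (𝓝 u) := by
  obtain ⟨u, hu⟩ := exists_tendsto_of_norm_apply_le 𝒰
    (fun k x y => entry_norm_bound_of_unitary (hU k) x y)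
  refine ⟨u, ?_, by simpa using hTU.add hu⟩
  rw [mem_unitaryGroup_iff]
  have h1 : Tendsto (fun k => U k * star (U k)) 𝒰 (𝓝 (u * star u)) := by
    simp only [star_eq_conjTranspose]
    exact ((continuous_id.matrix_mul continuous_id.matrix_conjTranspose).tendsto u).comp hu
  refine tendsto_nhds_unique h1 ?_
  simp only [fun k => mem_unitaryGroup_iff.1 (hU k)]
  exact tendsto_const_nhds

theorem tendsto_conj {α ι : Type*} [Fintype ι] {l : Filter α} {T B : α → Matrix ι ι ℂ}
    {u b : Matrix ι ι ℂ} (hT : Tendsto T l (𝓝 u)) (hB : Tendsto B l (𝓝 b)) :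
    Tendsto (fun k => (T k)ᴴ * B k * T k) l (𝓝 (uᴴ * b * u)) := by
  have h : Tendsto (fun k => (T k)ᴴ) l (𝓝 uᴴ) :=
    (continuous_id.matrix_conjTranspose.tendsto u).comp hT
  exact (h.mul hB).mul hT

/-- These are closed conditions on entries. They are taken from T and not from the approximating
unitary matrices, whose pivot pairs A2 does not prescribe. -/
theorem IsElementaryAt.of_tendsto {α : Type*} {l : Filter α} [l.NeBot] {T : α → BlockMatrix n}
    {u : BlockMatrix n} {p : Fin m × Fin m} (hu : Tendsto T l (𝓝 u))
    (hT : ∀ᶠ k in l, (T k).IsElementaryAt p) : u.IsElementaryAt p := by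
  intro x y h
  have h1 : Tendsto (fun k => T k x y) l (𝓝 (u x y)) := (hu.apply_nhds x).apply_nhds y
  refine tendsto_nhds_unique h1 (Tendsto.congr' ?_ tendsto_const_nhds)
  filter_upwards [hT] with k hk using (hk x y h).symm

theorem isUnit_block_of_tendsto {α : Type*} {l : Filter α} [l.NeBot] {T : α → BlockMatrix n}
    {u : BlockMatrix n} {r : Fin m} {c : ℝ} (hc : 0 < c) (hu : Tendsto T l (𝓝 u))
    (hT : ∀ᶠ k in l, c ≤ sigmaMin ((T k).block r r)) : IsUnit (u.block r r) := by
  rw [Matrix.isUnit_iff_isUnit_det, isUnit_iff_ne_zero, ← norm_pos_iff]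
  have h1 : Continuous fun X : BlockMatrix n => ‖(X.block r r).det‖ :=
    (continuous_id.matrix_submatrix _ _).matrix_det.norm
  refine lt_of_lt_of_le (pow_pos hc (n r)) (ge_of_tendsto ((h1.tendsto u).comp hu) ?_)
  filter_upwards [hT] with k hk using pow_sigmaMin_le_norm_det _ hc.le hk

/-- The matrix scaled to Frobenius norm one. -/
noncomputable def normalize (A : BlockMatrix n) : BlockMatrix n := (frobeniusNorm A)⁻¹ • A

theorem frobeniusNorm_normalize {A : BlockMatrix n} (hA : A ≠ 0) :
    frobeniusNorm (normalize A) = 1 := by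
  have h := frobeniusNorm_pos hA
  rw [normalize, frobeniusNorm_smul, abs_of_pos (inv_pos.2 h), inv_mul_cancel₀ h.ne']

theorem inv_smul_offNorm (A : BlockMatrix n) (B : BlockMatrix n) :
    offNorm ((frobeniusNorm A)⁻¹ • B) = offNorm B / frobeniusNorm A := by
  rw [offNorm_smul, abs_of_nonneg (inv_nonneg.2 (frobeniusNorm_nonneg A)), div_eq_inv_mul]

theorem offNorm_normalize (A : BlockMatrix n) :
    offNorm (normalize A) = offNorm A / frobeniusNorm A := inv_smul_offNorm A A

theorem offNorm_normalize_le_one {A : BlockMatrix n} (hA : A ≠ 0) :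
    offNorm (normalize A) ≤ 1 := by
  refine le_of_sq_le_sq ?_ zero_le_one
  have h := offNorm_sq_add (normalize A)
  rw [frobeniusNorm_normalize hA] at h
  rw [← h]
  exact le_add_of_nonneg_right (Finset.sum_nonneg fun _ _ => by positivity)

theorem norm_normalize_apply_le {A : BlockMatrix n} (hA : A ≠ 0)
    (x y : (r : Fin m) × Fin (n r)) : ‖normalize A x y‖ ≤ 1 :=
  (norm_apply_le_frobeniusNorm _ x y).trans_eq (frobeniusNorm_normalize hA)

theorem normalize_isHermitian {A : BlockMatrix n} (hA : A.IsHermitian) :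
    (normalize A).IsHermitian := by
  rw [Matrix.IsHermitian, normalize, Matrix.conjTranspose_smul, hA.eq, star_trivial]

/-- A sequence of congruence transformations which is asymptotically unitary. -/
structure IsAsymptoticallyUnitaryProcess (A T : ℕ → BlockMatrix n) : Prop where
  ne_zero : ∀ k, A k ≠ 0
  isHermitian : ∀ k, (A k).IsHermitian
  succ : ∀ k, A (k + 1) = (T k)ᴴ * A k * T k
  exists_unitary : ∃ U : ℕ → BlockMatrix n,
    (∀ k, U k ∈ unitaryGroup _ ℂ) ∧ Tendsto (fun k => T k - U k) atTop (𝓝 0)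

namespace IsAsymptoticallyUnitaryProcess

variable {A T : ℕ → BlockMatrix n} (hP : IsAsymptoticallyUnitaryProcess A T)
include hP

theorem inv_smul_succ (k : ℕ) :
    (frobeniusNorm (A k))⁻¹ • A (k + 1) = (T k)ᴴ * normalize (A k) * T k := by
  rw [hP.succ, normalize, Matrix.mul_smul, Matrix.smul_mul]

theorem exists_tendsto_transformation {α : Type*} (𝒰 : Ultrafilter α) {f : α → ℕ}
    (hf : Tendsto f 𝒰 atTop) :
    ∃ u : BlockMatrix n, u ∈ unitaryGroup _ ℂ ∧ Tendsto (fun k => T (f k)) 𝒰 (𝓝 u) := by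
  obtain ⟨U, hU, hTU⟩ := hP.exists_unitary
  exact exists_tendsto_unitary 𝒰 (fun k => hU (f k)) (hTU.comp hf)

theorem exists_tendsto_normalize {α : Type*} (𝒰 : Ultrafilter α) (f : α → ℕ) :
    ∃ b : BlockMatrix n, Tendsto (fun k => normalize (A (f k))) 𝒰 (𝓝 b) :=
  exists_tendsto_of_norm_apply_le 𝒰 fun k x y => norm_normalize_apply_le (hP.ne_zero (f k)) x y

/-- Along any ultrafilter finer than `atTop` the ratio tends to the norm of uᴴbu, where u is unitary
and b has norm one. -/
theorem tendsto_frobeniusNorm_ratio :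
    Tendsto (fun k => frobeniusNorm (A (k + 1)) / frobeniusNorm (A k)) atTop (𝓝 1) := by
  rw [tendsto_iff_ultrafilter]
  intro 𝒰 h𝒰
  obtain ⟨u, hu, hTu⟩ := hP.exists_tendsto_transformation 𝒰 (f := id) h𝒰
  obtain ⟨b, hb⟩ := hP.exists_tendsto_normalize 𝒰 id
  have hb1 : frobeniusNorm b = 1 := by
    refine tendsto_nhds_unique ((continuous_frobeniusNorm.tendsto b).comp hb) ?_
    simp only [Function.comp_def, frobeniusNorm_normalize (hP.ne_zero _)]
    exact tendsto_const_nhds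
  have h1 := (continuous_frobeniusNorm.tendsto _).comp (tendsto_conj hTu hb)
  rw [frobeniusNorm_conj hu, hb1] at h1
  refine h1.congr fun k => ?_
  simp only [Function.comp_def, id, ← hP.inv_smul_succ, frobeniusNorm_smul]
  rw [abs_of_nonneg (inv_nonneg.2 (frobeniusNorm_nonneg _)), div_eq_inv_mul]

theorem tendsto_normalize_succ {α : Type*} {l : Filter α} {f : α → ℕ} (hf : Tendsto f l atTop)
    {u b : BlockMatrix n} (hu : Tendsto (fun k => T (f k)) l (𝓝 u))
    (hb : Tendsto (fun k => normalize (A (f k))) l (𝓝 b)) :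
    Tendsto (fun k => normalize (A (f k + 1))) l (𝓝 (uᴴ * b * u)) := by
  have h1 := ((hP.tendsto_frobeniusNorm_ratio.comp hf).inv₀ one_ne_zero).smul (tendsto_conj hu hb)
  rw [inv_one, one_smul] at h1
  refine h1.congr fun k => ?_
  simp only [Function.comp_apply]
  rw [← hP.inv_smul_succ, smul_smul, normalize, inv_div, div_mul_eq_mul_div,
    mul_inv_cancel₀ (frobeniusNorm_pos (hP.ne_zero _)).ne', one_div]

/-- In the limit, every step is an exact unitary step which diagonalizes the pivot submatrix; it is
stationary if it preserves the off-norm. -/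
theorem limit_step {I : ℕ → Fin m × Fin m} (hI : ∀ k, (I k).1 ≠ (I k).2)
    (hT : ∀ k, (T k).IsElementaryAt (I k)) {c : ℝ} (hc : 0 < c)
    (hσ : ∀ᶠ k in atTop, c ≤ sigmaMin ((T k).block (I k).1 (I k).1))
    (h : Tendsto (fun k => offNorm ((A (k + 1)).pivotSubmatrix (I k)) / frobeniusNorm (A k))
        atTop (𝓝 0))
    {α : Type*} {𝒰 : Ultrafilter α} {f : α → ℕ} (hf : Tendsto f 𝒰 atTop)
    {p : Fin m × Fin m} (hp : ∀ᶠ k in (𝒰 : Filter α), I (f k) = p) {b b' : BlockMatrix n}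
    (hb : Tendsto (fun k => normalize (A (f k))) 𝒰 (𝓝 b))
    (hb' : Tendsto (fun k => normalize (A (f k + 1))) 𝒰 (𝓝 b')) :
    offNorm b' ≤ offNorm b ∧ (offNorm b' = offNorm b → IsStationaryStep p b b') := by
  obtain ⟨u, hu, hTu⟩ := hP.exists_tendsto_transformation 𝒰 hf
  obtain rfl : b' = uᴴ * b * u :=
    tendsto_nhds_unique hb' (hP.tendsto_normalize_succ hf hTu hb)
  have hue : u.IsElementaryAt p := .of_tendsto hTu (by
    filter_upwards [hp] with k hk using hk ▸ hT (f k))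
  have hne : p.1 ≠ p.2 := by
    obtain ⟨k, rfl⟩ := hp.exists
    exact hI _
  have hH : b.IsHermitian := by
    refine tendsto_nhds_unique
      ((continuous_id.matrix_conjTranspose.tendsto b).comp hb) (hb.congr fun k => ?_)
    exact (normalize_isHermitian (hP.isHermitian (f k))).eq.symm
  have hunit : IsUnit (block u p.1 p.1) := isUnit_block_of_tendsto hc hTu (by
    filter_upwards [hp, hf.eventually hσ] with k hk h' using hk ▸ h')
  have hdiag : IsPivotDiag (uᴴ * b * u) p := by
    refine isPivotDiag_of_offNorm_eq_zero ?_
    have h1 := ((continuous_offNorm.comp (continuous_pivotSubmatrix p)).tendsto _).comp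
      (tendsto_conj hTu hb)
    refine tendsto_nhds_unique h1 ((h.comp hf).congr' ?_)
    filter_upwards [hp] with k hk
    simp only [Function.comp_apply]
    rw [← hP.inv_smul_succ, pivotSubmatrix_smul, offNorm_smul, hk,
      abs_of_nonneg (inv_nonneg.2 (frobeniusNorm_nonneg _)), div_eq_inv_mul]
  exact ⟨hue.offNorm_le hu hdiag, fun e => ⟨hne, hH, hue.isPivotDiag_of_offNorm_eq hu hdiag e,
    hdiag, u, hue, hu, hunit, hue.isUnit_block_snd hne hu hunit, rfl⟩⟩

end IsAsymptoticallyUnitaryProcess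

/-! ### From stationary limit chains to convergence of the off-norm -/

theorem StationaryChain.of_forall {L : List (Fin m × Fin m)} {b : ℕ → BlockMatrix n} (c : ℕ)
    (h : ∀ t p, L[t]? = some p → IsStationaryStep p (b (c + t)) (b (c + t + 1))) :
    StationaryChain L (b c) (b (c + L.length)) := by
  induction L generalizing c with
  | nil => rfl
  | cons p L ih =>
    refine ⟨b (c + 1), h 0 p rfl, ?_⟩
    have := ih (c + 1) fun t q hq => by
      have := h (t + 1) q (by simpa using hq)
      rwa [show c + (t + 1) = c + 1 + t by ring] at this
    rwa [List.length_cons, show c + (L.length + 1) = c + 1 + L.length by ring]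

theorem StationaryChain.of_forall_replicate {O : List (Fin m × Fin m)} {b : ℕ → BlockMatrix n}
    (N c : ℕ) (h : ∀ t < O.length * N, ∀ p, O[t % O.length]? = some p →
      IsStationaryStep p (b (c + t)) (b (c + t + 1))) :
    StationaryChain (List.replicate N O).flatten (b c) (b (c + O.length * N)) := by
  induction N generalizing c with
  | zero => rfl
  | succ N ih =>
    rw [List.replicate_succ, List.flatten_cons, append_iff]
    refine ⟨b (c + O.length), .of_forall c fun t p hp => ?_, ?_⟩
    · obtain ⟨ht, -⟩ := List.getElem?_eq_some_iff.1 hp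
      exact h t (ht.trans_le (Nat.le_mul_of_pos_right _ N.succ_pos)) p
        (by rwa [Nat.mod_eq_of_lt ht])
    · have := ih (c + O.length) fun t ht p hp => by
        have := h (O.length + t) (by rw [Nat.mul_succ]; omega) p (by simpa using hp)
        rwa [← Nat.add_assoc] at this
      rwa [show c + O.length * (N + 1) = c + O.length + O.length * N by ring]

/-- If the pivot submatrices become diagonal along a cyclically diagonalizing ordering, then so do
the full matrices. -/
theorem IsAsymptoticallyUnitaryProcess.tendsto_offNorm {A T : ℕ → BlockMatrix n}
    (hP : IsAsymptoticallyUnitaryProcess A T) {O : List (Fin m × Fin m)}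
    (hO : ∃ N, IsDiagonalizing n (List.replicate N O).flatten)
    {I : ℕ → Fin m × Fin m} (hOI : IsStrategyOf O I) (hI : ∀ k, (I k).1 ≠ (I k).2)
    (hT : ∀ k, (T k).IsElementaryAt (I k)) {c : ℝ} (hc : 0 < c)
    (hσ : ∀ᶠ k in atTop, c ≤ sigmaMin ((T k).block (I k).1 (I k).1))
    (h : Tendsto (fun k => offNorm ((A (k + 1)).pivotSubmatrix (I k)) / frobeniusNorm (A k))
        atTop (𝓝 0)) :
    Tendsto (fun k => offNorm (A k) / frobeniusNorm (A k)) atTop (𝓝 0) := by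
  obtain ⟨N, hN⟩ := hO
  set M := O.length with hM
  have hMpos : 0 < M := by
    have := hOI 0
    by_contra h0
    rw [List.length_eq_zero_iff.1 (by omega : O.length = 0)] at this
    simp at this
  simp only [← offNorm_normalize]
  set φ : ℕ → ℝ := fun k => offNorm (normalize (A k)) with hφ
  have hφ1 : ∀ k, φ k ≤ 1 := fun k => offNorm_normalize_le_one (hP.ne_zero k)
  have hφ0 : ∀ k, 0 ≤ φ k := fun k => offNorm_nonneg _
  have hbdd : IsBoundedUnder (· ≤ ·) atTop φ := isBoundedUnder_of ⟨1, hφ1⟩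
  have hbdd' : IsBoundedUnder (· ≥ ·) atTop φ := isBoundedUnder_of ⟨0, hφ0⟩
  set ℓ := limsup φ atTop with hℓ
  suffices hzero : ℓ = 0 by
    exact tendsto_of_le_liminf_of_limsup_le
      (le_liminf_of_le hbdd.isCoboundedUnder_ge (Eventually.of_forall hφ0)) hzero.le hbdd hbdd'
  obtain ⟨𝒰, h𝒰, h𝒰φ⟩ := mapClusterPt_iff_ultrafilter.1
    (MapClusterPt.limsup hbdd'.isCoboundedUnder_le hbdd : MapClusterPt ℓ atTop φ)
  -- There are finitely many residues mod M, so one of them is constant along the ultrafilter.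
  obtain ⟨s, -, hs⟩ := (Ultrafilter.eventually_exists_mem_iff (f := 𝒰) (is := Set.Iio M)
    (P := fun s k => k % M = s) (Set.finite_Iio M)).1
    (Eventually.of_forall fun k => ⟨_, Nat.mod_lt k hMpos, rfl⟩)
  -- Start of the cycle lying N cycles before the one containing k. Eventually k = g k + MN + s;
  -- truncated subtraction matters only for k < MN.
  set g : ℕ → ℕ := fun k => M * (k / M - N) with hg
  have hgt : Tendsto g 𝒰 atTop := by
    have h1 : Tendsto (fun k => k / M - N) atTop atTop :=
      (tendsto_sub_atTop_nat N).comp (Nat.tendsto_div_const_atTop hMpos.ne')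
    exact (h1.const_mul_atTop' hMpos).mono_left h𝒰
  have hgt' (t : ℕ) : Tendsto (fun k => g k + t) 𝒰 atTop := 
    tendsto_atTop_mono (fun k => Nat.le_add_right _ t) hgt
  choose b hb using fun t => hP.exists_tendsto_normalize 𝒰 fun k => g k + t
  have hbφ (t : ℕ) : Tendsto (fun k => φ (g k + t)) 𝒰 (𝓝 (offNorm (b t))) :=
    (continuous_offNorm.tendsto (b t)).comp (hb t)
  have hIg (k t : ℕ) : I (g k + t) = I t := by
    have h1 := hOI (g k + t)
    rw [← hM, hg, Nat.mul_add_mod, hOI t] at h1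
    exact (Option.some_injective _ h1).symm
  have hstep (t : ℕ) := hP.limit_step hI hT hc hσ h (hgt' t)
    (Eventually.of_forall fun k => hIg k t) (hb t) (hb (t + 1))
  have hanti : Antitone fun t => offNorm (b t) := antitone_nat_of_succ_le fun t => (hstep t).1
  -- This value is a cluster value of the off-norms, hence at most their limsup.
  have hle : offNorm (b 0) ≤ ℓ := by
    have h1 : MapClusterPt (offNorm (b 0)) 𝒰 (φ ∘ fun k => g k + 0) := (hbφ 0).mapClusterPt
    exact (h1.of_comp (hgt' 0)).le_limsup hbdd
  have hend : offNorm (b (M * N + s)) = ℓ := by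
    refine tendsto_nhds_unique (hbφ _) (h𝒰φ.congr' ?_)
    filter_upwards [hs, h𝒰 (eventually_ge_atTop (M * N))] with k hk hk'
    congr 1
    have h1 : N ≤ k / M := (Nat.le_div_iff_mul_le hMpos).2 (by rwa [Nat.mul_comm])
    have h2 := Nat.div_add_mod k M
    rw [hg]
    dsimp only
    rw [← Nat.add_assoc, ← Nat.mul_add, Nat.sub_add_cancel h1, ← hk, h2]
  -- The limit off-norms decrease from at most ℓ to exactly ℓ, so they are constant and every step
  -- of the window is stationary.
  have hconst (t : ℕ) (ht : t ≤ M * N + s) : offNorm (b t) = ℓ :=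
    le_antisymm ((hanti (Nat.zero_le t)).trans hle) (hend ▸ hanti ht)
  have hchain : StationaryChain (List.replicate N O).flatten (b 0) (b (0 + M * N)) := by
    refine .of_forall_replicate N 0 fun t ht p hp => ?_
    rw [hOI t] at hp
    obtain rfl := Option.some_injective _ hp
    rw [Nat.zero_add]
    rw [← hM] at ht
    exact (hstep t).2 (by rw [hconst t (by omega), hconst (t + 1) (by omega)])
  rw [← hconst 0 (Nat.zero_le _), offNorm_eq_zero_iff]
  exact hN _ _ hchain

end BlockMatrix

/-! ### The equivalence for the block Jacobi-type process -/

theorem mainTheorem4 {m : ℕ} (hm : 2 ≤ m) (n : Fin m → ℕ) (hn : ∀ r, 1 ≤ n r)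
    (A₀ : BlockMatrix n) (hA₀ : A₀.IsHermitian) (hA₀' : A₀ ≠ 0)
    (I : ℕ → Fin m × Fin m) (A T : ℕ → BlockMatrix n)
    -- the block Jacobi-type process with nonsingular elementary block matrices
    (hT : ∀ k, (T k).IsElementaryAt (I k)) (hT' : ∀ k, IsUnit (T k))
    (hA_zero : A 0 = A₀) (hA_succ : ∀ k, A (k + 1) = (T k).conjTranspose * A k * T k)
    -- assumption A1
    (hA1 : ∃ O ∈ generalizedSerialOrderings m, IsStrategyOf O I)
    -- assumption A2
    (hA2 : ∃ U : ℕ → BlockMatrix n,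
      (∀ k, (U k).IsElementary ∧ U k ∈ Matrix.unitaryGroup ((r : Fin m) × Fin (n r)) ℂ) ∧
        Tendsto (fun k => T k - U k) atTop (𝓝 0))
    -- assumption A3, with `i` the first pivot index of step `k`
    (hA3 : 0 < liminf (fun k => (sigmaMin ((T k).block (I k).1 (I k).1) : EReal)) atTop) :
    Tendsto (fun k => offNorm ((A (k + 1)).pivotSubmatrix (I k)) / frobeniusNorm (A k))
        atTop (𝓝 0) ↔
      Tendsto (fun k => offNorm (A k) / frobeniusNorm (A k)) atTop (𝓝 0) := by
  obtain ⟨O, hO, hOI⟩ := hA1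
  obtain ⟨U, hU, hTU⟩ := hA2
  have hI (k : ℕ) : (I k).1 ≠ (I k).2 :=
    ((hO.1.2 _).1 (List.mem_of_getElem? (hOI k))).ne
  have hP : BlockMatrix.IsAsymptoticallyUnitaryProcess A T := by
    refine ⟨fun k => ?_, fun k => ?_, hA_succ, U, fun k => (hU k).2, hTU⟩
    · induction k with
      | zero => rwa [hA_zero]
      | succ k ih =>
        rw [hA_succ]
        intro h
        rw [(hT' k).mul_left_eq_zero] at h
        exact ih (((Matrix.isUnit_conjTranspose _).2 (hT' k)).mul_right_eq_zero.1 h)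
    · induction k with
      | zero => rwa [hA_zero]
      | succ k ih =>
        rw [hA_succ]
        exact Matrix.isHermitian_conjTranspose_mul_mul _ ih
  constructor
  · intro h
    -- The liminf is taken in `EReal`, so a real bound strictly between exists without any
    -- boundedness of the singular values.
    obtain ⟨c, hc, hc'⟩ := EReal.lt_iff_exists_real_btwn.1 hA3
    have hσ : ∀ᶠ k in atTop, c ≤ sigmaMin ((T k).block (I k).1 (I k).1) := by
      filter_upwards [eventually_lt_of_lt_liminf hc'] with k hk
      exact (EReal.coe_lt_coe_iff.1 hk).le
    have hdiag :=
      BlockMatrix.IsCyclicallyDiagonalizing.of_mem_generalizedSerialOrderings (n := n) hm hO 1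
    exact hP.tendsto_offNorm (by simpa using hdiag) hOI hI hT (EReal.coe_pos.1 hc) hσ h
  · intro h
    -- The off-norm of the new iterate must be divided by the old norm, hence the factor given by
    -- the ratio of consecutive norms.
    have h1 := (h.comp (tendsto_add_atTop_nat 1)).mul hP.tendsto_frobeniusNorm_ratio
    rw [zero_mul] at h1
    refine squeeze_zero (fun k => div_nonneg (offNorm_nonneg _) (frobeniusNorm_nonneg _))
      (fun k => ?_) h1
    simp only [Function.comp_apply]
    rw [div_mul_div_cancel₀ (frobeniusNorm_pos (hP.ne_zero _)).ne']
    gcongr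
    · exact frobeniusNorm_nonneg _
    · exact BlockMatrix.offNorm_pivotSubmatrix_le _ (hI k)
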